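/- Let $A_1,\dots,A_\ell\in\mathbb{Q}^{n\times n}$ be row stochastic matrices, let $u\in\mathbb{Q}^n$ be a probability vector, $v\in\{0,1\}^n$ and $\lambda\in[0,1]$. For a stochastic matrix $A$ let $A^\omega$ be the set of all limits of convergent subsequences of $(A^k)_{k\ge 1}$. For $k_1,\dots,k_\ell\in\mathbb{N}\cup\{\omega\}$ let $\langle u|A_1^{k_1}\cdots A_\ell^{k_\ell}|v\rangle$ denote the set of all numbers $u^\top M_1\cdots M_\ell v$, where $M_t=A_t^{k_t}$ if $k_t$ is finite and $M_t$ ranges over $A_t^\omega$ if $k_t=\omega$. Let $J=\{1,\dots,\ell\}$, let $J_F\subseteq J$, and fix a finite value $k_t\in\mathbb{N}$ for every $t\in J\setminus J_F$, the variables $k_t$ with $t\in J_F$ being free. Then - either $\lambda\in\langle u|A_1^{k_1}\cdots A_\ell^{k_\ell}|v\rangle$ where $k_t=\omega$ for all $t\in J_F$, - or else there is an integer constant $C>0$ such that for all choices of $k_t\in\mathbb{N}\cup\{\omega\}$, $t\in J_F$, if $\lambda\in\langle u|A_1^{k_1}\cdots A_\ell^{k_\ell}|v\rangle$, then $k_t<C$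 for at least one $t\in J_F$. Moreover, there is an algorithm that, given $A_1,\dots,A_\ell,u,v$, the set $J_F$, the fixed values $k_t$ ($t\in J\setminus J_F$) and an algebraic $\lambda\in[0,1]$, decides whether the first case holds, and there is an algorithm that, given the same data, computes such a constant $C$ whenever the first case does not hold. Here $\lambda$ is given by its standard representation $(p,a,b,r)$: $p\in\mathbb{Z}[x]$ is its defining polynomial (the nonzero polynomial of least degree vanishing at $\lambda$ that has coprime coefficients and a positive leading coefficient), and $a,b,r\in\mathbb{Q}$ are such that $\lambda$ is the only root of $p$ in the open disc with centre $a+bi$ and radius $r$. -/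

import Mathlib

open scoped Matrix Polynomial

noncomputable section

/-- The set `A^ω` of all limits of the sequence `A, A², A³, …`: the limits of its convergent
subsequences. -/
def limitPowers {n : ℕ} (A : Matrix (Fin n) (Fin n) ℝ) : Set (Matrix (Fin n) (Fin n) ℝ) :=
  {L | ∃ φ : ℕ → ℕ, StrictMono φ ∧
    Filter.Tendsto (fun m => A ^ φ m) Filter.atTop (nhds L)}

/-- The set `A^k` for `k ∈ ℕ ∪ {ω}` (with `ω` written `⊤`): the singleton of the usual power if `k`
is finite, and the set of all limits of powers if `k = ω`. -/
def genPower {n : ℕ} (A : Matrix (Fin n) (Fin n) ℝ) (k : ℕ∞) :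
    Set (Matrix (Fin n) (Fin n) ℝ) :=
  {M | (∃ j : ℕ, k = (j : ℕ∞) ∧ M = A ^ j) ∨ (k = ⊤ ∧ M ∈ limitPowers A)}

/-- Rational row stochastic matrices `A₁, …, A_ℓ` of size `n`, a rational initial distribution `u`,
a final state vector `v ∈ {0, 1}ⁿ`, and for every index `t` either a fixed finite value of the
exponent `k_t` (`some j`) or the declaration that `k_t` is free (`none`). -/
structure PowerProblem where
  n : ℕ
  ℓ : ℕ
  A : Fin ℓ → Matrix (Fin n) (Fin n) ℚ
  stochastic : ∀ t, A t ∈ Matrix.rowStochastic ℚ (Fin n)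
  u : Fin n → ℚ
  distribution : u ∈ stdSimplex ℚ (Fin n)
  v : Fin n → Bool
  fixed : Fin ℓ → Option ℕ

namespace PowerProblem

variable (I : PowerProblem)

/-- The set `J_F` of indices of free variables. -/
def JF : Set (Fin I.ℓ) := {t | I.fixed t = none}

/-- The real matrix `A_t`. -/
def realA (t : Fin I.ℓ) : Matrix (Fin I.n) (Fin I.n) ℝ := (I.A t).map (fun q : ℚ => (q : ℝ))

/-- The real vector `u`. -/
def realU : Fin I.n → ℝ := fun i => (I.u i : ℝ)

/-- The real vector `v`. -/
def realV : Fin I.n → ℝ := fun i => if I.v i then 1 else 0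

/-- The set of values `⟨u| A₁^{k₁} ⋯ A_ℓ^{k_ℓ} |v⟩` for exponents `k_t ∈ ℕ ∪ {ω}`, where every
limit in `A_t^ω` is substituted when `k_t = ω`. -/
def values (k : Fin I.ℓ → ℕ∞) : Set ℝ :=
  {x | ∃ M : Fin I.ℓ → Matrix (Fin I.n) (Fin I.n) ℝ,
    (∀ t, M t ∈ genPower (I.realA t) (k t)) ∧
    x = I.realU ⬝ᵥ ((List.ofFn M).prod *ᵥ I.realV)}

/-- The exponents `k` give every variable that is not free its fixed value. -/
def Respects (k : Fin I.ℓ → ℕ∞) : Prop := ∀ t (j : ℕ), I.fixed t = some j → k t = (j : ℕ∞)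

/-- All free variables set to `ω`, the others having their fixed values. -/
def omegaExponents : Fin I.ℓ → ℕ∞ := fun t => (I.fixed t).elim ⊤ (fun j => (j : ℕ∞))

/-- The first case: `x` is a value when all free variables are set to `ω`. -/
def AttainedAtOmega (x : ℝ) : Prop := x ∈ I.values I.omegaExponents

/-- The second case, with the constant `C`: whenever `x` is a value, for exponents in `ℕ ∪ {ω}` that
respect the fixed ones, at least one free exponent is less than `C`. -/
def IsBound (x : ℝ) (C : ℕ) : Prop :=
  0 < C ∧ ∀ k : Fin I.ℓ → ℕ∞, I.Respects k → x ∈ I.values k → ∃ t ∈ I.JF, k t < (C : ℕ∞)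

end PowerProblem

/-- A standard representation `(p, a, b, r)` of the algebraic number `α`: `p` is its defining
polynomial (of least degree, with positive leading coefficient and without a common factor of the
coefficients), and `α` is the unique root of `p` inside the circle with centre `a + bi` and
radius `r`. -/
structure StandardRep (α : ℂ) where
  p : ℤ[X]
  a : ℚ
  b : ℚ
  r : ℚ
  ne_zero : p ≠ 0
  root : Polynomial.aeval α p = 0
  least : ∀ q : ℤ[X], q ≠ 0 → Polynomial.aeval α q = 0 → p.natDegree ≤ q.natDegree
  leading_pos : 0 < p.leadingCoeff
  primitive : p.IsPrimitive
  inside : ‖α - ((a : ℂ) + (b : ℂ) * Complex.I)‖ < (r : ℝ)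
  unique : ∀ z : ℂ, Polynomial.aeval z p = 0 →
    ‖z - ((a : ℂ) + (b : ℂ) * Complex.I)‖ < (r : ℝ) → z = α

/-- Rationals as input data: numerator and denominator. -/
abbrev RatCode := ℤ × ℕ

/-- The input data of an algorithm: the list of matrices (as lists of rows), the vector `u`, the
vector `v`, the list of exponents (fixed or free), and a number as the coefficients of its defining
polynomial together with `a`, `b` and `r`. -/
abbrev InputCode :=
  (List (List (List RatCode)) × List RatCode × List Bool × List (Option ℕ)) ×
    (List ℤ × RatCode × RatCode × RatCode)

/-- Numerator and denominator of a rational number in lowest terms. -/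
def ratCode (q : ℚ) : RatCode := (q.num, q.den)

/-- The input that presents a problem together with an algebraic number. -/
def inputCode (I : PowerProblem) {α : ℂ} (ρ : StandardRep α) : InputCode :=
  ((List.ofFn fun t => List.ofFn fun i => List.ofFn fun j => ratCode (I.A t i j),
    List.ofFn fun i => ratCode (I.u i),
    List.ofFn I.v,
    List.ofFn I.fixed),
   ((List.range (ρ.p.natDegree + 1)).map ρ.p.coeff, ratCode ρ.a, ratCode ρ.b, ratCode ρ.r))

end

/-! ### Convergence of powers of a stochastic matrix along a multiple of its period. -/

section StochasticLimits

open Matrix Filter Topology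

variable {ι : Type*} [Fintype ι] [DecidableEq ι]

/-! The powers of a stochastic matrix are asymptotically periodic. The zero pattern of `A ^ k` is
eventually periodic in `k`, so some `X = A ^ e` has powers with no more support than `X`
(`exists_pow_support`). A limit `L` of Cesàro averages of powers of `X` satisfies `X * L = L * X = L
* L = L` and is dominated by a multiple of `X`. Splitting off `ε • L` from `X` gives geometric
convergence of `X ^ k` to `L` (`tendsto_pow_of_support`). Hence `A^ω` is the finite set of all `A ^
r * L` with `r < e`, and `L` is rational, being the projection onto the kernel of `1 - X` along its
range (`exists_rational_limit`).

A certificate consists of a common `e`, the limits `L t`, and `δ < 1` bounding the row-sum distance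
from `A_t ^ e` to `L t`. For `k ≥ e` the power `A_t ^ k` is within `δ` of `A_t ^ (k % e) * L t`.
Stochastic factors do not enlarge errors, so if all free exponents are at least `e`, every value
lies within `ℓ * δ` of one of the finitely many values at `ω` (`exists_close`). If `λ` is none of
these, a small enough `δ` makes `e` a valid constant `C`.

For the algorithms, certificates can be checked in rational arithmetic and exist for arbitrarily
small `δ`, so an unbounded search finds one. The values `w` at `ω` are rational, and the defining
polynomial `p` has no rational root other than `λ`, so `w = λ` iff `p(w) = 0`. If `B` bounds the
slope of `p` on `[0, 1]`, then `B * ℓ * δ < |p(w)|` implies `ℓ * δ < |λ - w|`. Thus each answer has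
a checkable witness; `Accepts.sound` and `exists_accepts` give correctness and termination. -/

theorem isClosed_rowStochastic : IsClosed (rowStochastic ℝ ι : Set (Matrix ι ι ℝ)) := by
  have h : (rowStochastic ℝ ι : Set (Matrix ι ι ℝ)) =
      (⋂ i, ⋂ j, {M | 0 ≤ M i j}) ∩ ⋂ i, {M | ∑ j, M i j = 1} := by
    ext M
    simp [mem_rowStochastic_iff_sum]
  rw [h]
  refine IsClosed.inter (isClosed_iInter fun i => isClosed_iInter fun j => ?_)
    (isClosed_iInter fun i => ?_)
  · exact isClosed_le continuous_const (by fun_prop)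
  · exact isClosed_eq (by fun_prop) continuous_const

theorem isCompact_rowStochastic : IsCompact (rowStochastic ℝ ι : Set (Matrix ι ι ℝ)) := by
  have h : IsCompact (Set.pi Set.univ fun _ : ι => Set.pi Set.univ fun _ : ι =>
      Set.Icc (0 : ℝ) 1) :=
    isCompact_univ_pi fun _ => isCompact_univ_pi fun _ => isCompact_Icc
  refine h.of_isClosed_subset isClosed_rowStochastic fun M hM i _ j _ => ?_
  exact ⟨nonneg_of_mem_rowStochastic hM, le_one_of_mem_rowStochastic hM⟩

/-- The Cesàro averages of the powers of a stochastic matrix accumulate at an idempotent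
stochastic matrix that absorbs it. -/
theorem exists_absorbing_idempotent {X : Matrix ι ι ℝ} (hX : X ∈ rowStochastic ℝ ι) :
    ∃ L ∈ rowStochastic ℝ ι, X * L = L ∧ L * X = L ∧ L * L = L ∧
      ∀ i j, (∀ k, (X ^ (k + 1)) i j = 0) → L i j = 0 := by
  -- The averages begin with the first power: the identity would spoil the final claim about entries
  -- that vanish in all positive powers.
  set c : ℕ → Matrix ι ι ℝ := fun N => ((N : ℝ) + 1)⁻¹ • ∑ k ∈ Finset.range (N + 1), X ^ (k + 1)
    with hc
  have hpow : ∀ k, X ^ k ∈ rowStochastic ℝ ι := fun k => pow_mem hX k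
  have hcK : ∀ N, c N ∈ rowStochastic ℝ ι := by
    intro N
    have hN : (0 : ℝ) < (N : ℝ) + 1 := by positivity
    rw [mem_rowStochastic_iff_sum]
    refine ⟨fun i j => ?_, fun i => ?_⟩
    · simp only [hc, Matrix.smul_apply, Matrix.sum_apply, smul_eq_mul]
      exact mul_nonneg (by positivity)
        (Finset.sum_nonneg fun k _ => nonneg_of_mem_rowStochastic (hpow _))
    · simp only [hc, Matrix.smul_apply, Matrix.sum_apply, smul_eq_mul]
      rw [← Finset.mul_sum, Finset.sum_comm,
        Finset.sum_congr rfl fun k _ => sum_row_of_mem_rowStochastic (hpow (k + 1)) i]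
      simp [hN.ne']
  have : FirstCountableTopology (Matrix ι ι ℝ) :=
    inferInstanceAs (FirstCountableTopology (ι → ι → ℝ))
  obtain ⟨L, hL, φ, hφ, hlim⟩ := isCompact_rowStochastic.tendsto_subseq hcK
  -- The sum telescopes to `X ^ (N + 2) - X`, whose entries lie in `[-1, 1]`.
  have hdiff : Tendsto (fun N => X * c N - c N) atTop (𝓝 0) := by
    have h1 : ∀ N, X * c N - c N = ((N : ℝ) + 1)⁻¹ • (X ^ (N + 2) - X) := by
      intro N
      simp only [hc]
      rw [mul_smul_comm, ← smul_sub, Finset.mul_sum, ← Finset.sum_sub_distrib]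
      congr 1
      have := Finset.sum_range_sub (fun k => X ^ (k + 1)) (N + 1)
      simp only [zero_add, pow_one] at this
      rw [← this]
      exact Finset.sum_congr rfl fun k _ => by rw [← pow_succ']
    simp only [h1]
    refine tendsto_pi_nhds.2 fun i => tendsto_pi_nhds.2 fun j => ?_
    refine squeeze_zero_norm (a := fun N : ℕ => ((N : ℝ) + 1)⁻¹) (fun N => ?_) ?_
    · have hN : (0 : ℝ) < ((N : ℝ) + 1)⁻¹ := by positivity
      simp only [Matrix.smul_apply, Matrix.sub_apply, smul_eq_mul, norm_mul, Real.norm_eq_abs, abs_of_pos hN]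
      refine mul_le_of_le_one_right hN.le (abs_le.2 ⟨?_, ?_⟩)
      · linarith [nonneg_of_mem_rowStochastic (hpow (N + 2)) (i := i) (j := j),
          le_one_of_mem_rowStochastic hX (i := i) (j := j)]
      · linarith [le_one_of_mem_rowStochastic (hpow (N + 2)) (i := i) (j := j),
          nonneg_of_mem_rowStochastic hX (i := i) (j := j)]
    · simpa using tendsto_one_div_add_atTop_nhds_zero_nat (𝕜 := ℝ)
  have hXc : ∀ N, X * c N = c N * X := fun N => by
    simp only [hc]
    rw [mul_smul_comm, smul_mul_assoc, Finset.mul_sum, Finset.sum_mul]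
    simp only [← pow_succ, ← pow_succ']
  have hXL : X * L = L := by
    have h1 : Tendsto (fun m => X * c (φ m) - c (φ m)) atTop (𝓝 (X * L - L)) :=
      (hlim.const_mul X).sub hlim
    exact sub_eq_zero.1 (tendsto_nhds_unique h1 (hdiff.comp hφ.tendsto_atTop))
  have hLX : L * X = L := by
    have h1 : Tendsto (fun m => c (φ m) * X) atTop (𝓝 (L * X)) := hlim.mul_const X
    have h2 : Tendsto (fun m => c (φ m) * X) atTop (𝓝 (X * L)) := by
      simp only [← hXc]
      exact hlim.const_mul X
    rw [tendsto_nhds_unique h1 h2, hXL]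
  have hXkL : ∀ k, X ^ k * L = L := by
    intro k
    induction k with
    | zero => simp
    | succ k ih => rw [pow_succ, mul_assoc, hXL, ih]
  refine ⟨L, hL, hXL, hLX, ?_, fun i j hij => ?_⟩
  · have h1 : Tendsto (fun m => c (φ m) * L) atTop (𝓝 (L * L)) := hlim.mul_const L
    have h2 : ∀ N, c N * L = L := by
      intro N
      have hN : (N : ℝ) + 1 ≠ 0 := by positivity
      simp only [hc, smul_mul_assoc, Finset.sum_mul, hXkL, Finset.sum_const, Finset.card_range]
      rw [← Nat.cast_smul_eq_nsmul ℝ, smul_smul]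
      push_cast
      rw [inv_mul_cancel₀ hN, one_smul]
    simp only [h2] at h1
    exact tendsto_nhds_unique h1 tendsto_const_nhds
  · have h1 : Tendsto (fun m => c (φ m) i j) atTop (𝓝 (L i j)) :=
      (tendsto_pi_nhds.1 (tendsto_pi_nhds.1 hlim i)) j
    have h2 : ∀ N, c N i j = 0 := fun N => by simp [hc, Matrix.sum_apply, hij]
    simp only [h2] at h1
    exact tendsto_nhds_unique h1 tendsto_const_nhds

/-- The powers of a stochastic matrix converge if its powers have no more positive entries than
the matrix itself. -/
theorem tendsto_pow_of_support {X : Matrix ι ι ℝ} (hX : X ∈ rowStochastic ℝ ι)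
    (hsupp : ∀ k i j, X i j = 0 → (X ^ (k + 1)) i j = 0) :
    ∃ L ∈ rowStochastic ℝ ι, X * L = L ∧ L * X = L ∧ L * L = L ∧
      Tendsto (fun k => X ^ k) atTop (𝓝 L) := by
  obtain ⟨L, hL, hXL, hLX, hLL, hz⟩ := exists_absorbing_idempotent hX
  refine ⟨L, hL, hXL, hLX, hLL, ?_⟩
  obtain ⟨ε, hε0, hε1, hε⟩ : ∃ ε : ℝ, 0 < ε ∧ ε < 1 ∧ ∀ i j, X i j ≠ 0 → ε ≤ X i j := by
    have h : ∃ ε : ℝ, 0 < ε ∧ ∀ p : ι × ι, X p.1 p.2 ≠ 0 → ε ≤ X p.1 p.2 := by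
      have h1 : ∀ᶠ ε in 𝓝[>] (0 : ℝ), ∀ p : ι × ι, X p.1 p.2 ≠ 0 → ε ≤ X p.1 p.2 := by
        refine eventually_all.2 fun p => ?_
        by_cases hp : X p.1 p.2 = 0
        · simp [hp]
        · have : 0 < X p.1 p.2 := lt_of_le_of_ne (nonneg_of_mem_rowStochastic hX) (Ne.symm hp)
          filter_upwards [nhdsWithin_le_nhds (eventually_lt_nhds this)] with ε h _ using h.le
      exact ((eventually_mem_nhdsWithin (s := Set.Ioi (0 : ℝ))).and h1).exists
    obtain ⟨ε, h0, h⟩ := h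
    exact ⟨min ε (1 / 2), by positivity, (min_le_right _ _).trans_lt (by norm_num),
      fun i j hij => (min_le_left _ _).trans (h (i, j) hij)⟩
  -- A Doeblin minorisation: where `X` vanishes so does `L`, by the support hypothesis, and
  -- elsewhere the entry of `X` is at least `ε`. The remainder `Y` is again stochastic.
  have hle : ∀ i j, ε * L i j ≤ X i j := by
    intro i j
    by_cases h : X i j = 0
    · rw [hz i j fun k => hsupp k i j h, h, mul_zero]
    · exact (mul_le_of_le_one_right hε0.le (le_one_of_mem_rowStochastic hL)).trans (hε i j h)
  have hd : 0 < 1 - ε := by linarith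
  set Y : Matrix ι ι ℝ := (1 - ε)⁻¹ • (X - ε • L) with hY
  have hYs : Y ∈ rowStochastic ℝ ι := by
    rw [mem_rowStochastic_iff_sum]
    refine ⟨fun i j => ?_, fun i => ?_⟩
    · simp only [hY, Matrix.smul_apply, Matrix.sub_apply, smul_eq_mul]
      exact mul_nonneg (by positivity) (sub_nonneg.2 (hle i j))
    · simp only [hY, Matrix.smul_apply, Matrix.sub_apply, smul_eq_mul]
      rw [← Finset.mul_sum, Finset.sum_sub_distrib, ← Finset.mul_sum,
        sum_row_of_mem_rowStochastic hX, sum_row_of_mem_rowStochastic hL]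
      field_simp
  have hXY : X = ε • L + (1 - ε) • Y := by
    rw [hY, smul_smul, mul_inv_cancel₀ hd.ne', one_smul]
    abel
  have hLY : L * Y = L := by
    rw [hY, mul_smul_comm, mul_sub, mul_smul_comm, hLX, hLL]
    nth_rewrite 1 [← one_smul ℝ L]
    rw [← sub_smul, smul_smul, inv_mul_cancel₀ hd.ne', one_smul]
  have hLYk : ∀ k, L * Y ^ k = L := by
    intro k
    induction k with
    | zero => simp
    | succ k ih => rw [pow_succ', ← mul_assoc, hLY, ih]
  -- Since `L * Y ^ k = L`, each multiplication by `X` contracts the difference by `1 - ε`.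
  have hmain : ∀ k, X ^ k - L = (1 - ε) ^ k • (Y ^ k - L) := by
    intro k
    induction k with
    | zero => simp
    | succ k ih =>
      have h1 : X ^ (k + 1) - L = X * (X ^ k - L) := by rw [mul_sub, hXL, pow_succ']
      have h2 : X * (Y ^ k - L) = (1 - ε) • (Y ^ (k + 1) - L) := by
        rw [mul_sub, hXL]
        nth_rewrite 1 [hXY]
        rw [add_mul, smul_mul_assoc, smul_mul_assoc, hLYk, ← pow_succ', smul_sub, sub_smul,
          sub_smul, one_smul, one_smul]
        abel
      rw [h1, ih, mul_smul_comm, h2, smul_smul, ← pow_succ]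
  rw [← tendsto_sub_nhds_zero_iff]
  refine tendsto_pi_nhds.2 fun i => tendsto_pi_nhds.2 fun j => ?_
  refine squeeze_zero_norm (a := fun k : ℕ => (1 - ε) ^ k) (fun k => ?_)
    (tendsto_pow_atTop_nhds_zero_of_lt_one hd.le (by linarith))
  rw [hmain]
  have hp : (0 : ℝ) < (1 - ε) ^ k := pow_pos hd k
  simp only [Matrix.smul_apply, Matrix.sub_apply, smul_eq_mul, norm_mul, Real.norm_eq_abs, abs_of_pos hp]
  have hYk := pow_mem hYs k
  refine mul_le_of_le_one_right hp.le (abs_le.2 ⟨?_, ?_⟩)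
  · linarith [nonneg_of_mem_rowStochastic hYk (i := i) (j := j),
      le_one_of_mem_rowStochastic hL (i := i) (j := j)]
  · linarith [le_one_of_mem_rowStochastic hYk (i := i) (j := j),
      nonneg_of_mem_rowStochastic hL (i := i) (j := j)]

/-- Nonnegative terms cannot cancel, so the zero pattern of a product depends only on the zero
patterns of the factors. -/
theorem mul_apply_eq_zero_iff_of_nonneg {κ : Type*} [Fintype κ] {M N : Matrix κ κ ℝ}
    (hM : ∀ i j, 0 ≤ M i j) (hN : ∀ i j, 0 ≤ N i j) (i j : κ) : (M * N) i j = 0 ↔ ∀ k, M i k = 0 ∨ N k j = 0 := by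
  rw [mul_apply, Finset.sum_eq_zero_iff_of_nonneg fun k _ => mul_nonneg (hM i k) (hN k j)]
  simp

/-- Some power of a stochastic matrix has a support that is stable under further powers. -/
theorem exists_pow_support {A : Matrix ι ι ℝ} (hA : A ∈ rowStochastic ℝ ι) :
    ∃ e, 0 < e ∧ ∀ k i j, (A ^ e) i j = 0 → ((A ^ e) ^ (k + 1)) i j = 0 := by
  have hnn : ∀ k i j, 0 ≤ (A ^ k) i j := fun k i j => nonneg_of_mem_rowStochastic (pow_mem hA k)
  -- Pigeonhole: there are only finitely many zero patterns.
  obtain ⟨a, b, hab, hEq⟩ : ∃ a b : ℕ, a < b ∧ ∀ i j, (A ^ a) i j = 0 ↔ (A ^ b) i j = 0 := by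
    obtain ⟨a, b, hne, h⟩ := Finite.exists_ne_map_eq_of_infinite
      (fun k : ℕ => fun i j => (A ^ k) i j = 0)
    have h' : ∀ i j, (A ^ a) i j = 0 ↔ (A ^ b) i j = 0 := fun i j =>
      iff_of_eq (congrFun (congrFun h i) j)
    rcases lt_or_gt_of_ne hne with hl | hl
    · exact ⟨a, b, hl, h'⟩
    · exact ⟨b, a, hl, fun i j => (h' i j).symm⟩
  obtain ⟨p, rfl⟩ := Nat.exists_eq_add_of_lt hab
  have hstep : ∀ m i j, (A ^ (a + m)) i j = 0 ↔ (A ^ (a + m + (p + 1))) i j = 0 := by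
    intro m i j
    rw [pow_add, show a + m + (p + 1) = (a + p + 1) + m by ring, pow_add A (a + p + 1),
      mul_apply_eq_zero_iff_of_nonneg (hnn _) (hnn _),
      mul_apply_eq_zero_iff_of_nonneg (hnn _) (hnn _)]
    simp only [hEq]
  have hmul : ∀ q m i j, (A ^ (a + m)) i j = 0 ↔ (A ^ (a + m + q * (p + 1))) i j = 0 := by
    intro q
    induction q with
    | zero => simp
    | succ q ih =>
      intro m i j
      rw [ih, show a + m + q * (p + 1) = a + (m + q * (p + 1)) by ring, hstep,
        show a + m + (q + 1) * (p + 1) = a + (m + q * (p + 1)) + (p + 1) by ring]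
  -- A multiple of the period `p + 1` that is at least the preperiod `a`: all its positive multiples
  -- give the same zero pattern.
  refine ⟨(a + 1) * (p + 1), by positivity, fun k i j h => ?_⟩
  rw [← pow_mul]
  have he : (a + 1) * (p + 1) = a + (a * p + p + 1) := by ring
  rw [he] at h
  rw [hmul (k * (a + 1))] at h
  convert h using 3
  ring

theorem exists_pow_tendsto {A : Matrix ι ι ℝ} (hA : A ∈ rowStochastic ℝ ι) :
    ∃ e, 0 < e ∧ ∃ L ∈ rowStochastic ℝ ι, A ^ e * L = L ∧ L * A ^ e = L ∧ L * L = L ∧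
      Tendsto (fun k => (A ^ e) ^ k) atTop (𝓝 L) := by
  obtain ⟨e, he, hs⟩ := exists_pow_support hA
  exact ⟨e, he, tendsto_pow_of_support (pow_mem hA e) hs⟩

/-- The limit of the powers of a rational matrix is rational. -/
theorem exists_rational_limit {X : Matrix ι ι ℚ} {L : Matrix ι ι ℝ}
    (hLX : L * X.map (fun q : ℚ => (q : ℝ)) = L)
    (hlim : Tendsto (fun k => X.map (fun q : ℚ => (q : ℝ)) ^ k) atTop (𝓝 L)) :
    ∃ Q : Matrix ι ι ℚ, Q.map (fun q : ℚ => (q : ℝ)) = L := by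
  set R : Matrix ι ι ℝ := X.map (fun q : ℚ => (q : ℝ)) with hR
  have hfix : ∀ Z : Matrix ι ι ℝ, R * Z = Z → L * Z = Z := by
    intro Z hZ
    have h1 : Tendsto (fun k => R ^ k * Z) atTop (𝓝 (L * Z)) := hlim.mul_const Z
    have h2 : ∀ k, R ^ k * Z = Z := by
      intro k
      induction k with
      | zero => simp
      | succ k ih => rw [pow_succ, mul_assoc, hZ, ih]
    simp only [h2] at h1
    exact tendsto_nhds_unique h1 tendsto_const_nhds
  set f : (ι → ℚ) →ₗ[ℚ] (ι → ℚ) := Matrix.toLin' (1 - X) with hf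
  have hcast : ∀ M N : Matrix ι ι ℚ, (M * N).map (fun q : ℚ => (q : ℝ)) =
      M.map (fun q : ℚ => (q : ℝ)) * N.map (fun q : ℚ => (q : ℝ)) := fun M N =>
    Matrix.map_mul (f := Rat.castHom ℝ)
  have hone : ((1 : Matrix ι ι ℚ) - X).map (fun q : ℚ => (q : ℝ)) = 1 - R := by
    ext i j
    simp [hR, Matrix.one_apply]
    split_ifs <;> simp
  -- If `(1 - R)² Z = 0`, then `(1 - R) Z` is fixed by `R`, hence by `L`; but `L * (1 - R) = 0`.
  have hker : ∀ z, f (f z) = 0 → f z = 0 := by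
    intro z hz
    -- The vector `z` repeated in every column, so that `hfix`, stated for square matrices, applies.
    set Z : Matrix ι ι ℚ := Matrix.of fun i _ => z i with hZ
    have hcol : ∀ (M : Matrix ι ι ℚ) i j, (M * Z) i j = (M *ᵥ z) i := fun M i j => by
      simp [mul_apply, mulVec, dotProduct, hZ]
    have h0 : (1 - X) * ((1 - X) * Z) = 0 := by
      ext i j
      rw [← mul_assoc, hcol, ← mulVec_mulVec]
      exact congrFun hz i
    have h1 : (1 - R) * ((1 - R) * Z.map (fun q : ℚ => (q : ℝ))) = 0 := by
      rw [← hone, ← hcast, ← hcast, h0]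
      ext i j
      simp
    have h2 : (1 - R) * Z.map (fun q : ℚ => (q : ℝ)) = 0 := by
      have h3 := hfix ((1 - R) * Z.map (fun q : ℚ => (q : ℝ))) (by
        rw [sub_mul, one_mul, sub_eq_zero] at h1
        exact h1.symm)
      rw [← h3, ← mul_assoc, mul_sub, mul_one, hLX, sub_self, zero_mul]
    rw [← hone, ← hcast] at h2
    ext i
    have h3 := congrFun (congrFun h2 i) i
    simp only [map_apply, hcol, Matrix.zero_apply, Rat.cast_eq_zero] at h3
    exact h3
  have hrange : LinearMap.range (f ∘ₗ f) = LinearMap.range f := by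
    have hk : LinearMap.ker (f ∘ₗ f) = LinearMap.ker f := by
      ext z
      simp only [LinearMap.mem_ker, LinearMap.comp_apply]
      exact ⟨hker z, fun h => by rw [h, map_zero]⟩
    refine Submodule.eq_of_le_of_finrank_eq (LinearMap.range_comp_le_range f f) ?_
    have h1 := LinearMap.finrank_range_add_finrank_ker (f ∘ₗ f)
    have h2 := LinearMap.finrank_range_add_finrank_ker f
    rw [hk] at h1
    omega
  have hcols : ∀ j, ∃ g : ι → ℚ, f (f g) = f (Pi.single j 1) := by
    intro j
    have h : f (Pi.single j 1) ∈ LinearMap.range (f ∘ₗ f) := hrange ▸ LinearMap.mem_range_self f _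
    exact h
  choose g hg using hcols
  set G : Matrix ι ι ℚ := Matrix.of fun i j => g j i with hG
  have hGeq : (1 - X) * ((1 - X) * G) = 1 - X := by
    ext i j
    have h := congrFun (hg j) i
    simp only [hf, toLin'_apply, mulVec_mulVec] at h
    rw [← mul_assoc]
    have h' : ((1 - X) *ᵥ Pi.single j 1) i = (1 - X) i j := by simp
    rw [← h', ← h]
    simp [mul_apply, mulVec, dotProduct, hG]
  -- With `E = (1 - X) * G`, the columns of `1 - E` are fixed by `X`, so `L` fixes `1 - E`, while
  -- `L` kills `E`. Therefore `L = L * (1 - E) + L * E = 1 - E`.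
  refine ⟨1 - (1 - X) * G, ?_⟩
  set E : Matrix ι ι ℝ := (1 - R) * G.map (fun q : ℚ => (q : ℝ)) with hE
  have hcE : (1 - (1 - X) * G).map (fun q : ℚ => (q : ℝ)) = 1 - E := by
    rw [hE, ← hone, ← hcast]
    ext i j
    simp [Matrix.one_apply]
    split_ifs <;> simp
  have hRE : (1 - R) * E = 1 - R := by
    rw [hE, ← hone, ← hcast, ← hcast, hGeq]
  have h1 : L * (1 - E) = 1 - E := by
    refine hfix _ ?_
    have : (1 - R) * (1 - E) = 0 := by rw [mul_sub, mul_one, hRE, sub_self]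
    rw [sub_mul, one_mul, sub_eq_zero] at this
    exact this.symm
  have h2 : L * E = 0 := by
    rw [hE, ← mul_assoc, mul_sub, mul_one, hLX, sub_self, zero_mul]
  rw [hcE, ← h1, mul_sub, h2, mul_one, sub_zero]

end StochasticLimits

/-! ### Row-sum estimates and certificates of convergence. -/

section Certificates

open Matrix Filter Topology

variable {n : ℕ}

/-- Every row of `M` is within `δ` of the corresponding row of `N`, in the `ℓ¹` norm. -/
def RowClose (M N : Matrix (Fin n) (Fin n) ℝ) (δ : ℝ) : Prop :=
  ∀ i, ∑ j, |M i j - N i j| ≤ δ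

/-- Submultiplicativity of the maximal row-sum norm, stated for one row of the left factor. -/
theorem sum_abs_mul_le {M N : Matrix (Fin n) (Fin n) ℝ} {i : Fin n} {a b : ℝ}
    (hM : ∑ j, |M i j| ≤ a) (hN : ∀ k, ∑ j, |N k j| ≤ b) (hb : 0 ≤ b) :
    ∑ j, |(M * N) i j| ≤ a * b :=
  calc ∑ j, |(M * N) i j| ≤ ∑ j, ∑ k, |M i k| * |N k j| := by
        refine Finset.sum_le_sum fun j _ => ?_
        rw [mul_apply]
        refine (Finset.abs_sum_le_sum_abs _ _).trans_eq ?_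
        simp only [abs_mul]
    _ = ∑ k, |M i k| * ∑ j, |N k j| := by
        rw [Finset.sum_comm]
        simp only [Finset.mul_sum]
    _ ≤ ∑ k, |M i k| * b :=
        Finset.sum_le_sum fun k _ => mul_le_mul_of_nonneg_left (hN k) (abs_nonneg _)
    _ ≤ a * b := by
        rw [← Finset.sum_mul]
        exact mul_le_mul_of_nonneg_right hM hb

theorem sum_abs_row_of_mem_rowStochastic {M : Matrix (Fin n) (Fin n) ℝ}
    (hM : M ∈ rowStochastic ℝ (Fin n)) (i : Fin n) : ∑ j, |M i j| = 1 := by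
  rw [← sum_row_of_mem_rowStochastic hM i]
  exact Finset.sum_congr rfl fun j _ => abs_of_nonneg (nonneg_of_mem_rowStochastic hM)

namespace RowClose

variable {M N P X : Matrix (Fin n) (Fin n) ℝ} {a b δ : ℝ}

theorem mul_left (h : RowClose M N δ) (hX : X ∈ rowStochastic ℝ (Fin n)) :
    RowClose (X * M) (X * N) δ := by
  intro i
  have hδ : 0 ≤ δ := (Finset.sum_nonneg fun _ _ => abs_nonneg _).trans (h i)
  have := sum_abs_mul_le (sum_abs_row_of_mem_rowStochastic hX i).le (N := M - N) h hδ
  simpa only [mul_sub, one_mul, Matrix.sub_apply] using this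

theorem mul_right (h : RowClose M N δ) (hX : X ∈ rowStochastic ℝ (Fin n)) :
    RowClose (M * X) (N * X) δ := by
  intro i
  have := sum_abs_mul_le (M := M - N) (h i)
    (fun k => (sum_abs_row_of_mem_rowStochastic hX k).le) zero_le_one
  simpa only [sub_mul, mul_one, Matrix.sub_apply] using this

theorem trans (h : RowClose M N a) (h' : RowClose N P b) : RowClose M P (a + b) := fun i =>
  calc ∑ j, |M i j - P i j| ≤ ∑ j, (|M i j - N i j| + |N i j - P i j|) :=
        Finset.sum_le_sum fun _ _ => abs_sub_le _ _ _
    _ ≤ a + b := by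
        rw [Finset.sum_add_distrib]
        exact add_le_add (h i) (h' i)

/-- Factors are exchanged one at a time. All others have row-sum norm one, so the errors simply add
up. -/
theorem listOfFn_prod {ℓ : ℕ} : ∀ {f g : Fin ℓ → Matrix (Fin n) (Fin n) ℝ},
    (∀ t, f t ∈ rowStochastic ℝ (Fin n)) → (∀ t, g t ∈ rowStochastic ℝ (Fin n)) →
    (∀ t, RowClose (f t) (g t) δ) →
    RowClose (List.ofFn f).prod (List.ofFn g).prod (ℓ * δ) := by
  induction ℓ with
  | zero => intro f g _ _ _ i; simp
  | succ ℓ ih =>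
    intro f g hf hg h
    rw [List.ofFn_succ, List.ofFn_succ, List.prod_cons, List.prod_cons]
    have hG : (List.ofFn fun t : Fin ℓ => g t.succ).prod ∈ rowStochastic ℝ (Fin n) := by
      refine list_prod_mem fun M hM => ?_
      obtain ⟨t, rfl⟩ := (List.mem_ofFn' _ _).1 hM
      exact hg _
    have := ((ih (fun t => hf t.succ) (fun t => hg t.succ) fun t => h t.succ).mul_left
      (hf 0)).trans ((h 0).mul_right hG)
    push_cast
    rwa [add_mul, one_mul]

theorem abs_dotProduct_sub_le (h : RowClose M N δ) {u v : Fin n → ℝ}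
    (hu : u ∈ stdSimplex ℝ (Fin n)) (hv : ∀ i, |v i| ≤ 1) :
    |u ⬝ᵥ M *ᵥ v - u ⬝ᵥ N *ᵥ v| ≤ δ := by
  rw [← dotProduct_sub, ← sub_mulVec]
  have hrow : ∀ i, |((M - N) *ᵥ v) i| ≤ δ := fun i => by
    refine le_trans ?_ (h i)
    change |∑ j, (M - N) i j * v j| ≤ _
    refine (Finset.abs_sum_le_sum_abs _ _).trans (Finset.sum_le_sum fun j _ => ?_)
    rw [abs_mul]
    exact mul_le_of_le_one_right (abs_nonneg _) (hv j)
  calc |u ⬝ᵥ (M - N) *ᵥ v| ≤ ∑ i, |u i * ((M - N) *ᵥ v) i| := Finset.abs_sum_le_sum_abs _ _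
    _ ≤ ∑ i, u i * δ := by
        refine Finset.sum_le_sum fun i _ => ?_
        rw [abs_mul, abs_of_nonneg (hu.1 i)]
        exact mul_le_mul_of_nonneg_left (hrow i) (hu.1 i)
    _ = δ := by rw [← Finset.sum_mul, hu.2, one_mul]

end RowClose

/-- The equations and the estimate which show that the powers of `A ^ e` converge to `L`. -/
structure LimitCertificate (A L : Matrix (Fin n) (Fin n) ℝ) (e : ℕ) (δ : ℝ) : Prop where
  left : A ^ e * L = L
  right : L * A ^ e = L
  idem : L * L = L
  close : RowClose (A ^ e) L δ

namespace LimitCertificate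

variable {A L : Matrix (Fin n) (Fin n) ℝ} {e : ℕ} {δ : ℝ}

theorem pow_mul (h : LimitCertificate A L e δ) (k : ℕ) : (A ^ e) ^ k * L = L := by
  induction k with
  | zero => simp
  | succ k ih => rw [pow_succ, mul_assoc, h.left, ih]

/-- The three equations give `(A ^ e) ^ (k + 1) - L = (A ^ e - L) ^ (k + 1)`, and the right side has
row sums at most `δ ^ (k + 1)`. -/
theorem tendsto (h : LimitCertificate A L e δ) (hδ : δ < 1) :
    Tendsto (fun k => (A ^ e) ^ k) atTop (𝓝 L) := by
  have hsub : ∀ k, (A ^ e) ^ (k + 1) - L = (A ^ e - L) ^ (k + 1) := by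
    intro k
    induction k with
    | zero => simp
    | succ k ih =>
      rw [pow_succ (A ^ e - L), ← ih, sub_mul, mul_sub, mul_sub, h.pow_mul, h.right, h.idem,
        ← pow_succ]
      abel
  -- The identity `hsub` needs a positive exponent: at exponent zero its sides would be `1 - L` and
  -- `1`.
  rw [← tendsto_add_atTop_iff_nat 1]
  refine tendsto_pi_nhds.2 fun i => tendsto_pi_nhds.2 fun j => ?_
  have hδ0 : 0 ≤ δ := (Finset.sum_nonneg fun _ _ => abs_nonneg _).trans (h.close i)
  have hb : ∀ k i, ∑ j, |((A ^ e - L) ^ (k + 1)) i j| ≤ δ ^ (k + 1) := by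
    intro k
    induction k with
    | zero =>
      intro i
      simpa using h.close i
    | succ k ih =>
      intro i
      rw [pow_succ (A ^ e - L), pow_succ δ]
      exact sum_abs_mul_le (ih i) h.close hδ0
  rw [← tendsto_sub_nhds_zero_iff]
  refine squeeze_zero_norm (a := fun k : ℕ => δ ^ (k + 1)) (fun k => ?_)
    ((tendsto_add_atTop_iff_nat 1).2 (tendsto_pow_atTop_nhds_zero_of_lt_one hδ0 hδ))
  rw [← Matrix.sub_apply, hsub, Real.norm_eq_abs]
  exact (Finset.single_le_sum (f := fun j => |((A ^ e - L) ^ (k + 1)) i j|)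
    (fun _ _ => abs_nonneg _) (Finset.mem_univ j)).trans (hb k i)

theorem mem_rowStochastic (h : LimitCertificate A L e δ) (hδ : δ < 1)
    (hA : A ∈ rowStochastic ℝ (Fin n)) : L ∈ rowStochastic ℝ (Fin n) :=
  isClosed_rowStochastic.mem_of_tendsto (h.tendsto hδ)
    (Eventually.of_forall fun k => pow_mem (pow_mem hA e) k)

/-- As `e ≤ k`, at least one factor `A ^ e` can be split off and replaced by `L`, which then absorbs
the other such factors; only `A ^ (k % e)` remains. -/
theorem rowClose_pow (h : LimitCertificate A L e δ) (he : 0 < e)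
    (hA : A ∈ rowStochastic ℝ (Fin n)) {k : ℕ} (hk : e ≤ k) :
    RowClose (A ^ k) (A ^ (k % e) * L) δ := by
  obtain ⟨q, hq⟩ : ∃ q, k / e = q + 1 := Nat.exists_eq_succ_of_ne_zero (Nat.div_pos hk he).ne'
  have hkq : A ^ k = A ^ (k % e) * ((A ^ e) ^ q * A ^ e) := by
    rw [← pow_succ, ← hq, ← _root_.pow_mul, ← pow_add, Nat.mod_add_div]
  have h1 := (h.close.mul_left (pow_mem (pow_mem hA e) q)).mul_left (pow_mem hA (k % e))
  rwa [h.pow_mul, ← hkq] at h1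

end LimitCertificate

/-- Some residue `r` modulo `e` occurs infinitely often in the subsequence. Along those indices the
powers are `A ^ r * (A ^ e) ^ q` with `q → ∞`, which determines the limit. -/
theorem limitPowers_eq {A L : Matrix (Fin n) (Fin n) ℝ} {e : ℕ} (he : 0 < e)
    (h : Tendsto (fun k => (A ^ e) ^ k) atTop (𝓝 L)) (M : Matrix (Fin n) (Fin n) ℝ) :
    M ∈ limitPowers A ↔ ∃ r < e, M = A ^ r * L := by
  constructor
  · rintro ⟨φ, hφ, hM⟩
    obtain ⟨r, hr⟩ : ∃ r : Fin e, ∃ᶠ m in atTop, φ m % e = r := by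
      by_contra! hcon
      obtain ⟨m, hm⟩ := (eventually_all.2 hcon).exists
      exact hm ⟨φ m % e, Nat.mod_lt _ he⟩ rfl
    refine ⟨r, r.2, ?_⟩
    have hne : ((atTop : Filter ℕ) ⊓ 𝓟 {m : ℕ | φ m % e = (r : ℕ)}).NeBot :=
      frequently_mem_iff_neBot.1 hr
    have h1 : Tendsto (fun m => A ^ (r : ℕ) * (A ^ e) ^ (φ m / e)) atTop
        (𝓝 (A ^ (r : ℕ) * L)) :=
      (h.comp ((Nat.tendsto_div_const_atTop he.ne').comp hφ.tendsto_atTop)).const_mul _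
    refine tendsto_nhds_unique (l := (atTop : Filter ℕ) ⊓ 𝓟 {m : ℕ | φ m % e = (r : ℕ)})
      (hM.mono_left inf_le_left)
      ((h1.mono_left inf_le_left).congr' ?_)
    refine eventually_inf_principal.2 (Eventually.of_forall fun m hm => ?_)
    change A ^ (r : ℕ) * (A ^ e) ^ (φ m / e) = A ^ φ m
    rw [← pow_mul, ← pow_add, ← (show φ m % e = (r : ℕ) from hm), Nat.mod_add_div]
  · rintro ⟨r, -, rfl⟩
    refine ⟨fun m => r + e * m, fun a b hab => ?_, ?_⟩
    · have := (Nat.mul_lt_mul_left he).2 hab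
      simpa using this
    · simp only [pow_add, pow_mul]
      exact h.const_mul _

end Certificates

/-! ### Values at `ω` and the dichotomy. -/

namespace PowerProblem

open Matrix Filter Topology

variable (I : PowerProblem)

/-- Matrices over `ℚ`, seen as matrices over `ℝ`. -/
noncomputable abbrev castMatrix {n : ℕ} : Matrix (Fin n) (Fin n) ℚ →+* Matrix (Fin n) (Fin n) ℝ :=
  (Rat.castHom ℝ).mapMatrix

theorem realA_eq (t : Fin I.ℓ) : I.realA t = castMatrix (I.A t) := rfl

theorem realA_mem (t : Fin I.ℓ) : I.realA t ∈ rowStochastic ℝ (Fin I.n) := by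
  have h := mem_rowStochastic_iff_sum.1 (I.stochastic t)
  refine mem_rowStochastic_iff_sum.2 ⟨fun i j => ?_, fun i => ?_⟩
  · exact Rat.cast_nonneg.2 (h.1 i j)
  · simp only [realA, map_apply]
    exact_mod_cast h.2 i

theorem realU_mem : I.realU ∈ stdSimplex ℝ (Fin I.n) :=
  ⟨fun i => Rat.cast_nonneg.2 (I.distribution.1 i), by
    simp only [realU]
    exact_mod_cast I.distribution.2⟩

theorem abs_realV_le (i : Fin I.n) : |I.realV i| ≤ 1 := by
  unfold realV
  split_ifs <;> simp

/-- The data which certify that `(A_t ^ e) ^ k` converges to `L t` for all `t`. -/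
structure IsCertificate (e : ℕ) (L : Fin I.ℓ → Matrix (Fin I.n) (Fin I.n) ℚ) (δ : ℝ) : Prop where
  pos : 0 < e
  lt_one : δ < 1
  cert : ∀ t, LimitCertificate (I.realA t) (castMatrix (L t)) e δ

/-- The factor with index `t`, when the exponent of a free variable is `ω` and runs through the
residue class of `r t`. -/
def residueFactor (L : Fin I.ℓ → Matrix (Fin I.n) (Fin I.n) ℚ) (r : Fin I.ℓ → ℕ) (t : Fin I.ℓ) :
    Matrix (Fin I.n) (Fin I.n) ℚ :=
  (I.fixed t).elim (I.A t ^ r t * L t) fun j => I.A t ^ j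

/-- The vector `v` over the rationals. -/
def ratV : Fin I.n → ℚ := fun i => if I.v i then 1 else 0

/-- The value obtained from the factors `residueFactor`. -/
def residueValue (L : Fin I.ℓ → Matrix (Fin I.n) (Fin I.n) ℚ) (r : Fin I.ℓ → ℕ) : ℚ :=
  I.u ⬝ᵥ (List.ofFn (I.residueFactor L r)).prod *ᵥ I.ratV

theorem cast_residueValue (L : Fin I.ℓ → Matrix (Fin I.n) (Fin I.n) ℚ) (r : Fin I.ℓ → ℕ) :
    (I.residueValue L r : ℝ) =
      I.realU ⬝ᵥ (List.ofFn fun t => castMatrix (I.residueFactor L r t)).prod *ᵥ I.realV := by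
  have h : (List.ofFn fun t => castMatrix (I.residueFactor L r t)).prod =
      castMatrix (List.ofFn (I.residueFactor L r)).prod := by
    rw [map_list_prod, List.map_ofFn]
    rfl
  rw [h]
  simp [residueValue, dotProduct, mulVec, realU, realV, ratV, apply_ite (Rat.cast : ℚ → ℝ)]

theorem castMatrix_residueFactor (L : Fin I.ℓ → Matrix (Fin I.n) (Fin I.n) ℚ) (r : Fin I.ℓ → ℕ)
    (t : Fin I.ℓ) : castMatrix (I.residueFactor L r t) =
      (I.fixed t).elim (I.realA t ^ r t * castMatrix (L t)) fun j => I.realA t ^ j := by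
  unfold residueFactor
  cases I.fixed t with
  | none => simp only [Option.elim_none, map_mul, map_pow, realA_eq]
  | some j => simp only [Option.elim_some, map_pow, realA_eq]

/-- Needed because the slope bound for the defining polynomial is valid only on `[0, 1]`. -/
theorem mem_Icc_of_mem_values {k : Fin I.ℓ → ℕ∞} {x : ℝ} (hx : x ∈ I.values k) :
    x ∈ Set.Icc (0 : ℝ) 1 := by
  obtain ⟨M, hM, rfl⟩ := hx
  have hMs : ∀ t, M t ∈ rowStochastic ℝ (Fin I.n) := by
    intro t
    rcases hM t with ⟨j, -, h⟩ | ⟨-, φ, -, hlim⟩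
    · exact h ▸ pow_mem (I.realA_mem t) j
    · exact isClosed_rowStochastic.mem_of_tendsto hlim
        (Eventually.of_forall fun m => pow_mem (I.realA_mem t) _)
  have hP : (List.ofFn M).prod ∈ rowStochastic ℝ (Fin I.n) := by
    refine list_prod_mem fun N hN => ?_
    obtain ⟨t, rfl⟩ := (List.mem_ofFn' _ _).1 hN
    exact hMs t
  have hv0 : ∀ i, 0 ≤ I.realV i := fun i => by unfold realV; split_ifs <;> simp
  have hrow : ∀ i, ((List.ofFn M).prod *ᵥ I.realV) i ≤ 1 := fun i => by
    rw [← sum_row_of_mem_rowStochastic hP i]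
    change ∑ j, (List.ofFn M).prod i j * I.realV j ≤ _
    exact Finset.sum_le_sum fun j _ => mul_le_of_le_one_right (nonneg_of_mem_rowStochastic hP)
      ((le_abs_self _).trans (I.abs_realV_le j))
  have hu := I.realU_mem
  have hrow0 : ∀ i, 0 ≤ ((List.ofFn M).prod *ᵥ I.realV) i := fun i => by
    change 0 ≤ ∑ j, (List.ofFn M).prod i j * I.realV j
    exact Finset.sum_nonneg fun j _ => mul_nonneg (nonneg_of_mem_rowStochastic hP) (hv0 j)
  constructor
  · exact Finset.sum_nonneg fun i _ => mul_nonneg (hu.1 i) (hrow0 i)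
  · rw [← hu.2]
    exact Finset.sum_le_sum fun i _ => mul_le_of_le_one_right (hu.1 i) (hrow i)

namespace IsCertificate

variable {I} {e : ℕ} {L : Fin I.ℓ → Matrix (Fin I.n) (Fin I.n) ℚ} {δ : ℝ}

theorem residueFactor_mem (h : I.IsCertificate e L δ) (r : Fin I.ℓ → ℕ) (t : Fin I.ℓ) :
    castMatrix (I.residueFactor L r t) ∈ rowStochastic ℝ (Fin I.n) := by
  rw [castMatrix_residueFactor]
  cases I.fixed t with
  | none =>
    exact mul_mem (pow_mem (I.realA_mem t) _) ((h.cert t).mem_rowStochastic h.lt_one (I.realA_mem t))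
  | some j => exact pow_mem (I.realA_mem t) _

/-- Exponents `ω` in all free variables yield the values `residueValue` and no others. -/
theorem mem_values_omega_iff (h : I.IsCertificate e L δ) (x : ℝ) :
    x ∈ I.values I.omegaExponents ↔
      ∃ r : Fin I.ℓ → Fin e, (I.residueValue L fun t => r t : ℝ) = x := by
  have hpow : ∀ t M, M ∈ genPower (I.realA t) (I.omegaExponents t) ↔
      ∃ r : Fin e, M = castMatrix (I.residueFactor L (fun _ => r) t) := by
    intro t M
    simp only [castMatrix_residueFactor, omegaExponents, genPower]
    cases I.fixed t with
    | none =>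
      have := limitPowers_eq h.pos ((h.cert t).tendsto h.lt_one) M
      simp only [Option.elim_none, Set.mem_ofPred_eq, ENat.top_ne_natCast, false_and, exists_false,
        true_and, false_or, this]
      exact ⟨fun ⟨r, hr, hM⟩ => ⟨⟨r, hr⟩, hM⟩, fun ⟨r, hM⟩ => ⟨r, r.2, hM⟩⟩
    | some j =>
      simp only [Option.elim_some, Set.mem_ofPred_eq, ENat.natCast_ne_top, false_and, or_false,
        Nat.cast_inj]
      exact ⟨fun ⟨i, hi, hM⟩ => ⟨⟨0, h.pos⟩, by rw [hM, hi]⟩, fun ⟨_, hM⟩ => ⟨j, rfl, hM⟩⟩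
  constructor
  · rintro ⟨M, hM, rfl⟩
    choose r hr using fun t => (hpow t (M t)).1 (hM t)
    refine ⟨r, ?_⟩
    rw [cast_residueValue]
    congr 4
    funext t
    rw [hr t]
    rfl
  · rintro ⟨r, rfl⟩
    refine ⟨fun t => castMatrix (I.residueFactor L (fun t => r t) t), fun t => ?_, ?_⟩
    · exact (hpow t _).2 ⟨r t, rfl⟩
    · rw [cast_residueValue]

theorem finite_values (h : I.IsCertificate e L δ) : (I.values I.omegaExponents).Finite := by
  refine (Set.finite_range fun r : Fin I.ℓ → Fin e =>
    (I.residueValue L fun t => r t : ℝ)).subset fun x hx => ?_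
  exact (h.mem_values_omega_iff x).1 hx

/-- A free factor is within `δ` of a factor at `ω` when its exponent is finite, and equal to one
when it is `ω`; fixed factors agree. There are `ℓ` factors in total. -/
theorem exists_close (h : I.IsCertificate e L δ) {k : Fin I.ℓ → ℕ∞} (hk : I.Respects k)
    (hle : ∀ t ∈ I.JF, (e : ℕ∞) ≤ k t) {x : ℝ} (hx : x ∈ I.values k) :
    ∃ w ∈ I.values I.omegaExponents, |x - w| ≤ I.ℓ * δ := by
  obtain ⟨M, hM, rfl⟩ := hx
  have hfac : ∀ t, ∃ r : Fin e, M t ∈ rowStochastic ℝ (Fin I.n) ∧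
      RowClose (M t) (castMatrix (I.residueFactor L (fun _ => r) t)) δ := by
    intro t
    have hδ0 : ∀ N : Matrix (Fin I.n) (Fin I.n) ℝ, RowClose N N δ := fun N i => by
      have := (Finset.sum_nonneg fun _ _ => abs_nonneg _).trans ((h.cert t).close i)
      simpa using this
    simp only [castMatrix_residueFactor]
    cases hf : I.fixed t with
    | some j =>
      have hg := hM t
      rw [hk t j hf] at hg
      rcases hg with ⟨i, hi, hMi⟩ | ⟨hj, -⟩
      · rw [hMi, ← Nat.cast_inj.1 hi]
        exact ⟨⟨0, h.pos⟩, pow_mem (I.realA_mem t) j, hδ0 _⟩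
      · exact absurd hj (ENat.natCast_ne_top j)
    | none =>
      rcases hM t with ⟨j, hj, hMj⟩ | ⟨-, hMt⟩
      · have hej : e ≤ j := by
          have := hle t hf
          rw [hj] at this
          exact_mod_cast this
        refine ⟨⟨j % e, Nat.mod_lt _ h.pos⟩, hMj ▸ pow_mem (I.realA_mem t) j, ?_⟩
        rw [hMj]
        exact (h.cert t).rowClose_pow h.pos (I.realA_mem t) hej
      · obtain ⟨r, hr, hMr⟩ := (limitPowers_eq h.pos ((h.cert t).tendsto h.lt_one) _).1 hMt
        refine ⟨⟨r, hr⟩, ?_, ?_⟩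
        · rw [hMr]
          exact mul_mem (pow_mem (I.realA_mem t) _)
            ((h.cert t).mem_rowStochastic h.lt_one (I.realA_mem t))
        · rw [hMr]
          exact hδ0 _
  choose r hMs hr using hfac
  refine ⟨_, (h.mem_values_omega_iff _).2 ⟨r, rfl⟩, ?_⟩
  rw [cast_residueValue]
  exact (RowClose.listOfFn_prod hMs (fun t => h.residueFactor_mem _ t) hr).abs_dotProduct_sub_le
    I.realU_mem I.abs_realV_le

/-- The exponent of the certificate itself serves as `C`: free exponents all at least `e` would put
`x` within `ℓ * δ` of a value at `ω`. -/
theorem isBound (h : I.IsCertificate e L δ) {x : ℝ}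
    (hx : ∀ w ∈ I.values I.omegaExponents, I.ℓ * δ < |x - w|) : I.IsBound x e := by
  refine ⟨h.pos, fun k hk hxk => ?_⟩
  by_contra! hcon
  obtain ⟨w, hw, hle⟩ := h.exists_close hk hcon hxk
  exact (hx w hw).not_ge hle

end IsCertificate

/-- Passing to multiples of the individual exponents preserves the equations and makes the distance
to the limit arbitrarily small. -/
theorem exists_isCertificate {δ : ℝ} (hδ0 : 0 < δ) (hδ1 : δ < 1) :
    ∃ e L, I.IsCertificate e L δ := by
  have hex : ∀ t, ∃ e, 0 < e ∧ ∃ L : Matrix (Fin I.n) (Fin I.n) ℚ,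
      I.realA t ^ e * castMatrix L = castMatrix L ∧ castMatrix L * I.realA t ^ e = castMatrix L ∧
      castMatrix L * castMatrix L = castMatrix L ∧
      Tendsto (fun k => (I.realA t ^ e) ^ k) atTop (𝓝 (castMatrix L)) := by
    intro t
    obtain ⟨e, he, L, -, h1, h2, h3, hlim⟩ := exists_pow_tendsto (I.realA_mem t)
    have hX : (I.A t ^ e).map (fun q : ℚ => (q : ℝ)) = I.realA t ^ e := by
      rw [realA_eq, ← map_pow]
      rfl
    obtain ⟨Q, rfl⟩ := exists_rational_limit (X := I.A t ^ e) (L := L) (by rw [hX, h2])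
      (by rw [hX]; exact hlim)
    exact ⟨e, he, Q, h1, h2, h3, hlim⟩
  choose e he L h1 h2 h3 hlim using hex
  set E := ∏ t, e t with hE
  have hEpos : 0 < E := Finset.prod_pos fun t _ => he t
  have hev : ∀ t, ∀ᶠ m in atTop, RowClose (I.realA t ^ (E * m)) (castMatrix (L t)) δ := by
    intro t
    obtain ⟨q, hq⟩ : e t ∣ E := Finset.dvd_prod_of_mem _ (Finset.mem_univ t)
    have hqpos : 0 < q := Nat.pos_of_mul_pos_left (hq ▸ hEpos)
    have hl : Tendsto (fun m => I.realA t ^ (E * m)) atTop (𝓝 (castMatrix (L t))) := by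
      have := (hlim t).comp (tendsto_id.const_mul_atTop' hqpos)
      refine this.congr fun m => ?_
      simp only [Function.comp_apply, id, ← pow_mul, hq, mul_assoc]
    refine eventually_all.2 fun i => ?_
    have hs : Tendsto (fun m => ∑ j, |(I.realA t ^ (E * m)) i j - castMatrix (L t) i j|) atTop
        (𝓝 (∑ j, |castMatrix (L t) i j - castMatrix (L t) i j|)) :=
      tendsto_finsetSum _ fun j _ =>
        ((tendsto_pi_nhds.1 (tendsto_pi_nhds.1 hl i) j).sub_const _).abs
    simp only [sub_self, abs_zero, Finset.sum_const_zero] at hs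
    exact (hs.eventually_lt_const hδ0).mono fun m hm => hm.le
  -- The product `E` makes the exponent common to all matrices; the factor `m` achieves the error
  -- `δ`.
  obtain ⟨m, hm, hm0⟩ := ((eventually_all.2 hev).and (eventually_gt_atTop 0)).exists
  refine ⟨E * m, L, Nat.mul_pos hEpos hm0, hδ1, fun t => ?_⟩
  obtain ⟨q, hq⟩ : e t ∣ E * m := (Finset.dvd_prod_of_mem _ (Finset.mem_univ t)).mul_right m
  have h1' : ∀ q, (I.realA t ^ e t) ^ q * castMatrix (L t) = castMatrix (L t) := by
    intro q
    induction q with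
    | zero => simp
    | succ q ih => rw [pow_succ, mul_assoc, h1, ih]
  have h2' : ∀ q, castMatrix (L t) * (I.realA t ^ e t) ^ q = castMatrix (L t) := by
    intro q
    induction q with
    | zero => simp
    | succ q ih => rw [pow_succ', ← mul_assoc, h2, ih]
  refine ⟨?_, ?_, h3 t, hm t⟩
  · rw [hq, pow_mul, h1']
  · rw [hq, pow_mul, h2']

theorem finite_values_omega : (I.values I.omegaExponents).Finite := by
  obtain ⟨e, L, h⟩ := I.exists_isCertificate (δ := 1 / 2) (by norm_num) (by norm_num)
  exact h.finite_values

/-- A finite set of positive numbers is bounded away from zero. The function is general because both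
the distance to `x` and the absolute value of the defining polynomial are needed. -/
theorem exists_gap (f : ℝ → ℝ) (hf : ∀ w ∈ I.values I.omegaExponents, 0 < f w) :
    ∃ η > 0, ∀ w ∈ I.values I.omegaExponents, η < f w := by
  have h1 : ∀ᶠ η in 𝓝[>] (0 : ℝ), ∀ w ∈ I.values I.omegaExponents, η < f w :=
    (eventually_all_finite I.finite_values_omega).2 fun w hw =>
      nhdsWithin_le_nhds (eventually_lt_nhds (hf w hw))
  exact ((eventually_mem_nhdsWithin (s := Set.Ioi (0 : ℝ))).and h1).exists

theorem attainedAtOmega_or_isBound (x : ℝ) : I.AttainedAtOmega x ∨ ∃ C : ℕ, I.IsBound x C := by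
  refine or_iff_not_imp_left.2 fun hx => ?_
  obtain ⟨η, hη, hgap⟩ := I.exists_gap (fun w => |x - w|) fun w hw =>
    abs_pos.2 (sub_ne_zero.2 fun h => hx (h ▸ hw))
  -- The denominator `ℓ + 1` covers `ℓ = 0`; the cap `1 / 2` keeps `δ < 1`.
  have hδ : 0 < min (η / (I.ℓ + 1)) (1 / 2) := by positivity
  obtain ⟨e, L, h⟩ := I.exists_isCertificate hδ ((min_le_right _ _).trans_lt (by norm_num))
  refine ⟨e, h.isBound fun w hw => lt_of_le_of_lt ?_ (hgap w hw)⟩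
  calc (I.ℓ : ℝ) * min (η / (I.ℓ + 1)) (1 / 2) ≤ (I.ℓ + 1) * (η / (I.ℓ + 1)) := by
        gcongr
        · linarith
        · exact min_le_left _ _
    _ = η := by field_simp

end PowerProblem

/-! ### Testing an algebraic number against rationals through its defining polynomial. -/

section DefiningPolynomial

open Polynomial

/-- The value at `x` of the polynomial with the given coefficients, by Horner's scheme. -/
def horner {R : Type*} [Ring R] (cs : List ℤ) (x : R) : R :=
  cs.foldr (fun (c : ℤ) y => (c : R) + x * y) 0

/-- A bound for the values and for the slope on `[0, 1]` of a polynomial with given coefficients. -/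
def hornerBound (cs : List ℤ) : ℚ := cs.foldr (fun (c : ℤ) y => |(c : ℚ)| + 2 * y) 0

theorem hornerBound_nonneg (cs : List ℤ) : 0 ≤ hornerBound cs := by
  induction cs with
  | nil => exact le_rfl
  | cons c cs ih =>
    change 0 ≤ |(c : ℚ)| + 2 * hornerBound cs
    positivity

theorem abs_horner_le (cs : List ℤ) {x : ℝ} (hx : x ∈ Set.Icc (0 : ℝ) 1) :
    |horner cs x| ≤ hornerBound cs := by
  induction cs with
  | nil => simp [horner, hornerBound]
  | cons c cs ih =>
    have h0 : (0 : ℝ) ≤ hornerBound cs := by exact_mod_cast hornerBound_nonneg cs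
    change |(c : ℝ) + x * horner cs x| ≤ ((|(c : ℚ)| + 2 * hornerBound cs : ℚ) : ℝ)
    push_cast
    have h1 : |x * horner cs x| ≤ hornerBound cs := by
      rw [abs_mul, abs_of_nonneg hx.1]
      exact (mul_le_of_le_one_left (abs_nonneg _) hx.2).trans ih
    linarith [abs_add_le (c : ℝ) (x * horner cs x)]

theorem abs_horner_sub_le (cs : List ℤ) {x y : ℝ} (hx : x ∈ Set.Icc (0 : ℝ) 1)
    (hy : y ∈ Set.Icc (0 : ℝ) 1) :
    |horner cs x - horner cs y| ≤ hornerBound cs * |x - y| := by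
  induction cs with
  | nil => simp [horner, hornerBound]
  | cons c cs ih =>
    change |((c : ℝ) + x * horner cs x) - (c + y * horner cs y)| ≤
      ((|(c : ℚ)| + 2 * hornerBound cs : ℚ) : ℝ) * |x - y|
    push_cast
    -- Each summand is at most `hornerBound cs * |x - y|`, the first by induction and the second by
    -- the bound on values; this accounts for the factor 2 in `hornerBound`.
    have h1 : ((c : ℝ) + x * horner cs x) - (c + y * horner cs y) =
        x * (horner cs x - horner cs y) + (x - y) * horner cs y := by ring
    have h2 : |x * (horner cs x - horner cs y)| ≤ hornerBound cs * |x - y| := by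
      rw [abs_mul, abs_of_nonneg hx.1]
      exact (mul_le_of_le_one_left (abs_nonneg _) hx.2).trans ih
    have h3 : |(x - y) * horner cs y| ≤ hornerBound cs * |x - y| := by
      rw [abs_mul, mul_comm]
      exact mul_le_mul_of_nonneg_right (abs_horner_le cs hy) (abs_nonneg _)
    rw [h1]
    have h4 : 0 ≤ |(c : ℝ)| * |x - y| := by positivity
    linarith [abs_add_le (x * (horner cs x - horner cs y)) ((x - y) * horner cs y)]

theorem cast_horner (cs : List ℤ) (s : ℚ) : ((horner cs s : ℚ) : ℝ) = horner cs (s : ℝ) := by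
  induction cs with
  | nil => simp [horner]
  | cons c cs ih =>
    change (((c : ℚ) + s * horner cs s : ℚ) : ℝ) = (c : ℝ) + s * horner cs (s : ℝ)
    rw [← ih]
    push_cast
    rfl

theorem horner_map_range {R : Type*} [CommRing R] (f : ℕ → ℤ) (m : ℕ) (x : R) :
    horner ((List.range m).map f) x = ∑ i ∈ Finset.range m, (f i : R) * x ^ i := by
  induction m generalizing f with
  | zero => simp [horner]
  | succ m ih =>
    rw [List.range_succ_eq_map, List.map_cons, List.map_map, Finset.sum_range_succ']
    change (f 0 : R) + x * horner ((List.range m).map (f ∘ Nat.succ)) x = _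
    rw [ih, Finset.mul_sum, pow_zero, mul_one, add_comm]
    congr 1
    refine Finset.sum_congr rfl fun i _ => ?_
    simp only [Function.comp_apply, pow_succ]
    ring

theorem horner_coeff {R : Type*} [CommRing R] (p : ℤ[X]) (x : R) :
    horner ((List.range (p.natDegree + 1)).map p.coeff) x = aeval x p := by
  rw [horner_map_range, aeval_eq_sum_range]
  simp only [zsmul_eq_mul]

namespace StandardRep

/-- The defining polynomial has no rational root besides the number that it defines. -/
theorem eq_of_aeval_rat_eq_zero {α : ℂ} (ρ : StandardRep α) {s : ℚ} (hs : aeval s ρ.p = 0) :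
    α = s := by
  set P : ℚ[X] := ρ.p.map (algebraMap ℤ ℚ) with hP
  have hinj : Function.Injective (algebraMap ℤ ℚ) := (algebraMap ℤ ℚ).injective_int
  have hP0 : P ≠ 0 := (Polynomial.map_ne_zero_iff hinj).2 ρ.ne_zero
  have hroot : P.IsRoot s := by rw [hP, IsRoot.def, eval_map_algebraMap, hs]
  -- Either `α = s`, or `α` is a root of the cofactor `q`. Clearing denominators in `q` then
  -- contradicts the minimality of the degree.
  obtain ⟨q, hq⟩ := dvd_iff_isRoot.2 hroot
  have hαP : aeval α P = 0 := by rw [hP, aeval_map_algebraMap, ρ.root]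
  rw [hq, map_mul, mul_eq_zero] at hαP
  rcases hαP with h | h
  · simpa [sub_eq_zero] using h
  · exfalso
    have hq0 : q ≠ 0 := by
      rintro rfl
      exact hP0 (by rw [hq, mul_zero])
    obtain ⟨b, hbm, hb⟩ := IsLocalization.integerNormalization_spec (nonZeroDivisors ℤ) q
    set Q := IsLocalization.integerNormalization (nonZeroDivisors ℤ) q with hQ
    have hb0 : b ≠ 0 := nonZeroDivisors.ne_zero hbm
    have hmap : Q.map (algebraMap ℤ ℚ) = C (b : ℚ) * q := by
      rw [hb, ← Int.cast_smul_eq_zsmul ℚ, smul_eq_C_mul]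
    have hbq : (b : ℚ) ≠ 0 := by exact_mod_cast hb0
    have hQ0 : Q ≠ 0 := by
      intro h0
      rw [h0, Polynomial.map_zero, eq_comm, mul_eq_zero, C_eq_zero] at hmap
      exact hmap.elim hbq hq0
    have hQα : aeval α Q = 0 := by
      rw [← aeval_map_algebraMap (A := ℚ), hmap, map_mul, h, mul_zero]
    have hdegQ : Q.natDegree = q.natDegree := by
      rw [← natDegree_map_eq_of_injective hinj, hmap, natDegree_C_mul hbq]
    have hdegP : ρ.p.natDegree = q.natDegree + 1 := by
      rw [← natDegree_map_eq_of_injective hinj, ← hP, hq, natDegree_mul (X_sub_C_ne_zero s) hq0,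
        natDegree_X_sub_C, add_comm]
    have := ρ.least Q hQ0 hQα
    omega

/-- Values at `ω` are rational, so this turns the question whether `x` is one of them into exact
rational arithmetic. -/
theorem horner_eq_zero_iff {x : ℝ} (ρ : StandardRep (x : ℂ)) (s : ℚ) :
    horner ((List.range (ρ.p.natDegree + 1)).map ρ.p.coeff) s = 0 ↔ x = s := by
  rw [horner_coeff]
  constructor
  · intro h
    exact_mod_cast ρ.eq_of_aeval_rat_eq_zero h
  · rintro rfl
    have h := ρ.root
    generalize ρ.p = p at h ⊢
    have h1 : ((s : ℝ) : ℂ) = algebraMap ℚ ℂ s := by simp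
    rw [h1, aeval_algebraMap_apply] at h
    exact (map_eq_zero_iff _ (algebraMap ℚ ℂ).injective).1 h

theorem horner_self {x : ℝ} (ρ : StandardRep (x : ℂ)) :
    horner ((List.range (ρ.p.natDegree + 1)).map ρ.p.coeff) x = 0 := by
  rw [horner_coeff]
  have h : aeval (algebraMap ℝ ℂ x) ρ.p = 0 := ρ.root
  rw [aeval_algebraMap_apply] at h
  exact (map_eq_zero_iff _ (algebraMap ℝ ℂ).injective).1 h

end StandardRep

end DefiningPolynomial

/-! ### Primitive recursive arithmetic of rationals. -/

/-- Codes of rational numbers that admit simple arithmetic: `(a, b, c)` stands for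
`(a - b) / (c + 1)`. -/
abbrev FracCode := ℕ × ℕ × ℕ

namespace FracCode

/-- The rational number with the given code. -/
def val (x : FracCode) : ℚ := ((x.1 : ℚ) - x.2.1) / (x.2.2 + 1)

/-- Denominators are stored diminished by one, and `(c + 1) * (d + 1) = (c * d + c + d) + 1`. -/
def add (x y : FracCode) : FracCode :=
  (x.1 * (y.2.2 + 1) + y.1 * (x.2.2 + 1), x.2.1 * (y.2.2 + 1) + y.2.1 * (x.2.2 + 1),
    x.2.2 * y.2.2 + x.2.2 + y.2.2)

def mul (x y : FracCode) : FracCode :=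
  (x.1 * y.1 + x.2.1 * y.2.1, x.1 * y.2.1 + x.2.1 * y.1, x.2.2 * y.2.2 + x.2.2 + y.2.2)

/-- The numerators of `x` and `y`, after the negative terms have changed sides. -/
def cross (x y : FracCode) : ℕ := x.1 * (y.2.2 + 1) + y.2.1 * (x.2.2 + 1)

/-- A code of `|x - y|`. -/
def dist (x y : FracCode) : FracCode :=
  -- Subtraction is truncated, so at most one of the two differences is nonzero and their sum is the
  -- absolute difference.
  ((cross x y - cross y x) + (cross y x - cross x y), 0, x.2.2 * y.2.2 + x.2.2 + y.2.2)

def Lt (x y : FracCode) : Prop := cross x y < cross y x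

def Le (x y : FracCode) : Prop := cross x y ≤ cross y x

def ofNat (k : ℕ) : FracCode := (k, 0, 0)

def ofRatCode (q : RatCode) : FracCode := (q.1.toNat, (-q.1).toNat, q.2 - 1)

theorem val_add (x y : FracCode) : val (add x y) = val x + val y := by
  simp only [val, add]
  push_cast
  have hx : (x.2.2 : ℚ) + 1 ≠ 0 := by positivity
  have hy : (y.2.2 : ℚ) + 1 ≠ 0 := by positivity
  have hxy : (x.2.2 : ℚ) * y.2.2 + x.2.2 + y.2.2 + 1 = (x.2.2 + 1) * (y.2.2 + 1) := by ring
  rw [hxy]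
  field_simp
  ring

theorem val_mul (x y : FracCode) : val (mul x y) = val x * val y := by
  simp only [val, mul]
  push_cast
  have hx : (x.2.2 : ℚ) + 1 ≠ 0 := by positivity
  have hy : (y.2.2 : ℚ) + 1 ≠ 0 := by positivity
  have hxy : (x.2.2 : ℚ) * y.2.2 + x.2.2 + y.2.2 + 1 = (x.2.2 + 1) * (y.2.2 + 1) := by ring
  rw [hxy]
  field_simp
  ring

theorem val_sub_val (x y : FracCode) :
    val x - val y = ((cross x y : ℚ) - cross y x) / ((x.2.2 + 1) * (y.2.2 + 1)) := by
  simp only [val, cross]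
  push_cast
  have hx : (x.2.2 : ℚ) + 1 ≠ 0 := by positivity
  have hy : (y.2.2 : ℚ) + 1 ≠ 0 := by positivity
  field_simp
  ring

theorem val_dist (x y : FracCode) : val (dist x y) = |val x - val y| := by
  have hxy : ((x.2.2 : ℚ) * y.2.2 + x.2.2 + y.2.2) + 1 = (x.2.2 + 1) * (y.2.2 + 1) := by ring
  have hpos : (0 : ℚ) < (x.2.2 + 1) * (y.2.2 + 1) := by positivity
  rw [val_sub_val, abs_div, abs_of_pos hpos]
  simp only [val, dist]
  push_cast
  rw [hxy, sub_zero]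
  congr 1
  rcases le_total (cross x y) (cross y x) with h | h
  · have h' : (cross x y : ℚ) ≤ cross y x := by exact_mod_cast h
    rw [Nat.sub_eq_zero_of_le h, Nat.cast_sub h, abs_of_nonpos (sub_nonpos.2 h')]
    push_cast
    ring
  · have h' : (cross y x : ℚ) ≤ cross x y := by exact_mod_cast h
    rw [Nat.sub_eq_zero_of_le h, Nat.cast_sub h, abs_of_nonneg (sub_nonneg.2 h')]
    push_cast
    ring

theorem lt_iff (x y : FracCode) : Lt x y ↔ val x < val y := by
  have hpos : (0 : ℚ) < (x.2.2 + 1) * (y.2.2 + 1) := by positivity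
  rw [← sub_neg, val_sub_val, div_lt_iff₀ hpos, zero_mul, sub_neg, Nat.cast_lt, Lt]

theorem le_iff (x y : FracCode) : Le x y ↔ val x ≤ val y := by
  rw [← not_lt, ← lt_iff, Le, Lt, not_lt]

@[simp] theorem val_ofNat (k : ℕ) : val (ofNat k) = k := by simp [val, ofNat]

theorem intCast_eq_toNat_sub (z : ℤ) : (z : ℚ) = (z.toNat : ℚ) - ((-z).toNat : ℚ) := by
  have h := Int.toNat_sub_toNat_neg z
  exact_mod_cast h.symm

theorem val_ofRatCode (q : ℚ) : val (ofRatCode (ratCode q)) = q := by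
  have hd : ((q.den - 1 : ℕ) : ℚ) + 1 = q.den := by
    exact_mod_cast Nat.sub_add_cancel q.pos
  simp only [val, ofRatCode, ratCode]
  rw [hd, ← intCast_eq_toNat_sub, Rat.num_div_den]

theorem val_ofRatCode_int (z : ℤ) : val (ofRatCode (z, 1)) = z := by
  simp only [val, ofRatCode]
  rw [← intCast_eq_toNat_sub]
  simp

section Primrec

variable {α : Type*} [Primcodable α] {f g : α → FracCode}

theorem primrec_add (hf : Primrec f) (hg : Primrec g) : Primrec fun a => add (f a) (g a) := by
  have f1 := Primrec.fst.comp hf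
  have f2 := Primrec.fst.comp (Primrec.snd.comp hf)
  have f3 := Primrec.snd.comp (Primrec.snd.comp hf)
  have g1 := Primrec.fst.comp hg
  have g2 := Primrec.fst.comp (Primrec.snd.comp hg)
  have g3 := Primrec.snd.comp (Primrec.snd.comp hg)
  exact (Primrec.nat_add.comp (Primrec.nat_mul.comp f1 (Primrec.succ.comp g3))
    (Primrec.nat_mul.comp g1 (Primrec.succ.comp f3))).pair
    ((Primrec.nat_add.comp (Primrec.nat_mul.comp f2 (Primrec.succ.comp g3))
      (Primrec.nat_mul.comp g2 (Primrec.succ.comp f3))).pair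
    (Primrec.nat_add.comp (Primrec.nat_add.comp (Primrec.nat_mul.comp f3 g3) f3) g3))

theorem primrec_mul (hf : Primrec f) (hg : Primrec g) : Primrec fun a => mul (f a) (g a) := by
  have f1 := Primrec.fst.comp hf
  have f2 := Primrec.fst.comp (Primrec.snd.comp hf)
  have f3 := Primrec.snd.comp (Primrec.snd.comp hf)
  have g1 := Primrec.fst.comp hg
  have g2 := Primrec.fst.comp (Primrec.snd.comp hg)
  have g3 := Primrec.snd.comp (Primrec.snd.comp hg)
  exact (Primrec.nat_add.comp (Primrec.nat_mul.comp f1 g1) (Primrec.nat_mul.comp f2 g2)).pair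
    ((Primrec.nat_add.comp (Primrec.nat_mul.comp f1 g2) (Primrec.nat_mul.comp f2 g1)).pair
    (Primrec.nat_add.comp (Primrec.nat_add.comp (Primrec.nat_mul.comp f3 g3) f3) g3))

theorem primrec_cross (hf : Primrec f) (hg : Primrec g) : Primrec fun a => cross (f a) (g a) := by
  have f1 := Primrec.fst.comp hf
  have f3 := Primrec.snd.comp (Primrec.snd.comp hf)
  have g2 := Primrec.fst.comp (Primrec.snd.comp hg)
  have g3 := Primrec.snd.comp (Primrec.snd.comp hg)
  exact Primrec.nat_add.comp (Primrec.nat_mul.comp f1 (Primrec.succ.comp g3))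
    (Primrec.nat_mul.comp g2 (Primrec.succ.comp f3))

theorem primrec_dist (hf : Primrec f) (hg : Primrec g) : Primrec fun a => dist (f a) (g a) := by
  have f3 := Primrec.snd.comp (Primrec.snd.comp hf)
  have g3 := Primrec.snd.comp (Primrec.snd.comp hg)
  have h1 := primrec_cross hf hg
  have h2 := primrec_cross hg hf
  exact (Primrec.nat_add.comp (Primrec.nat_sub.comp h1 h2) (Primrec.nat_sub.comp h2 h1)).pair
    ((Primrec.const 0).pair
    (Primrec.nat_add.comp (Primrec.nat_add.comp (Primrec.nat_mul.comp f3 g3) f3) g3))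

theorem primrecPred_lt (hf : Primrec f) (hg : Primrec g) : PrimrecPred fun a => Lt (f a) (g a) :=
  Primrec.nat_lt.comp (primrec_cross hf hg) (primrec_cross hg hf)

theorem primrecPred_le (hf : Primrec f) (hg : Primrec g) : PrimrecPred fun a => Le (f a) (g a) :=
  Primrec.nat_le.comp (primrec_cross hf hg) (primrec_cross hg hf)

theorem primrec_ofNat {k : α → ℕ} (hk : Primrec k) : Primrec fun a => ofNat (k a) :=
  hk.pair (Primrec.const (0, 0))

/-- Integers are encoded by parity: `k` as `2 * k` and `-(k + 1)` as `2 * k + 1`. -/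
theorem primrec_toNat : Primrec Int.toNat := by
  have h : Primrec fun z : ℤ => if Encodable.encode z % 2 = 0 then Encodable.encode z / 2 else 0 :=
    Primrec.ite (Primrec.eq.comp (Primrec.nat_mod.comp Primrec.encode (Primrec.const 2))
      (Primrec.const 0)) (Primrec.nat_div.comp Primrec.encode (Primrec.const 2)) (Primrec.const 0)
  refine h.of_eq fun z => ?_
  cases z with
  | ofNat k =>
    have : Encodable.encode (Int.ofNat k) = 2 * k := rfl
    rw [this]
    simp
  | negSucc k =>
    have : Encodable.encode (Int.negSucc k) = 2 * k + 1 := rfl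
    rw [this, if_neg (by omega)]
    rfl

theorem primrec_neg_toNat : Primrec fun z : ℤ => (-z).toNat := by
  have h : Primrec fun z : ℤ =>
      if Encodable.encode z % 2 = 0 then 0 else Encodable.encode z / 2 + 1 :=
    Primrec.ite (Primrec.eq.comp (Primrec.nat_mod.comp Primrec.encode (Primrec.const 2))
      (Primrec.const 0)) (Primrec.const 0)
      (Primrec.succ.comp (Primrec.nat_div.comp Primrec.encode (Primrec.const 2)))
  refine h.of_eq fun z => ?_
  cases z with
  | ofNat k =>
    have : Encodable.encode (Int.ofNat k) = 2 * k := rfl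
    rw [this, if_pos (by omega)]
    simp
  | negSucc k =>
    have : Encodable.encode (Int.negSucc k) = 2 * k + 1 := rfl
    rw [this, if_neg (by omega), Int.neg_negSucc]
    change (2 * k + 1) / 2 + 1 = k + 1
    omega

theorem primrec_ofRatCode : Primrec ofRatCode :=
  (primrec_toNat.comp Primrec.fst).pair ((primrec_neg_toNat.comp Primrec.fst).pair
    (Primrec.pred.comp Primrec.snd))

end Primrec

/-- The sum `f 0 + ⋯ + f (n - 1)`. -/
def sumTo (n : ℕ) (f : ℕ → FracCode) : FracCode :=
  n.rec (ofNat 0) fun i s => add s (f i)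

theorem val_sumTo (n : ℕ) (f : ℕ → FracCode) :
    val (sumTo n f) = ∑ i : Fin n, val (f i) := by
  rw [Fin.sum_univ_eq_sum_range fun i => val (f i)]
  induction n with
  | zero => simp [sumTo]
  | succ n ih =>
    rw [Finset.sum_range_succ, ← ih, ← val_add]
    rfl

theorem primrec_sumTo {α : Type*} [Primcodable α] {n : α → ℕ} {f : α → ℕ → FracCode}
    (hn : Primrec n) (hf : Primrec fun p : α × ℕ => f p.1 p.2) :
    Primrec fun a => sumTo (n a) (f a) := by
  refine Primrec.nat_rec' hn (Primrec.const (ofNat 0))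
    (h := fun a p => add p.2 (f a p.1)) (Primrec₂.mk ?_)
  exact primrec_add (Primrec.snd.comp Primrec.snd)
    (hf.comp (Primrec.fst.pair (Primrec.fst.comp Primrec.snd)))

end FracCode

/-! ### Primitive recursive matrix arithmetic. -/

/-- Codes of matrices: lists of rows. -/
abbrev MatCode := List (List FracCode)

namespace MatCode

open FracCode Matrix

def entry (M : MatCode) (i j : ℕ) : FracCode := (M.getD i []).getD j (FracCode.ofNat 0)

def tabulate (n : ℕ) (f : ℕ → ℕ → FracCode) : MatCode :=
  (List.range n).map fun i => (List.range n).map (f i)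

def mul (n : ℕ) (M N : MatCode) : MatCode :=
  tabulate n fun i j => sumTo n fun k => FracCode.mul (entry M i k) (entry N k j)

def one (n : ℕ) : MatCode := tabulate n fun i j => FracCode.ofNat (if i = j then 1 else 0)

def pow (n : ℕ) (M : MatCode) (k : ℕ) : MatCode := k.rec (one n) fun _ P => mul n P M

/-- The sum of all `|M i j - N i j|`. -/
def dist (n : ℕ) (M N : MatCode) : FracCode :=
  sumTo n fun i => sumTo n fun j => FracCode.dist (entry M i j) (entry N i j)

/-- The rational matrix with the given code. -/
def toMatrix (n : ℕ) (M : MatCode) : Matrix (Fin n) (Fin n) ℚ := fun i j => val (entry M i j)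

theorem entry_tabulate {n : ℕ} (f : ℕ → ℕ → FracCode) {i j : ℕ} (hi : i < n) (hj : j < n) :
    entry (tabulate n f) i j = f i j := by
  simp [entry, tabulate, hi, hj]

theorem toMatrix_tabulate (n : ℕ) (f : ℕ → ℕ → FracCode) (i j : Fin n) :
    toMatrix n (tabulate n f) i j = val (f i j) := by
  rw [toMatrix, entry_tabulate f i.2 j.2]

theorem toMatrix_mul (n : ℕ) (M N : MatCode) :
    toMatrix n (mul n M N) = toMatrix n M * toMatrix n N := by
  ext i j
  rw [mul, toMatrix_tabulate, val_sumTo, Matrix.mul_apply]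
  simp only [val_mul, toMatrix]

theorem toMatrix_one (n : ℕ) : toMatrix n (one n) = 1 := by
  ext i j
  rw [one, toMatrix_tabulate, val_ofNat, Matrix.one_apply]
  simp [Fin.ext_iff]

theorem toMatrix_pow (n : ℕ) (M : MatCode) (k : ℕ) :
    toMatrix n (pow n M k) = toMatrix n M ^ k := by
  induction k with
  | zero => exact toMatrix_one n
  | succ k ih => rw [pow_succ, ← ih, ← toMatrix_mul]; rfl

theorem val_dist (n : ℕ) (M N : MatCode) :
    val (dist n M N) = ∑ i, ∑ j, |toMatrix n M i j - toMatrix n N i j| := by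
  simp only [dist, val_sumTo, FracCode.val_dist, toMatrix]

/-- Codes of rationals are not unique, so equality of matrices is tested by comparing a distance
with zero. -/
theorem val_dist_nonpos_iff (n : ℕ) (M N : MatCode) :
    val (dist n M N) ≤ 0 ↔ toMatrix n M = toMatrix n N := by
  rw [val_dist]
  constructor
  · intro h
    have h0 := le_antisymm h
      (Finset.sum_nonneg fun i _ => Finset.sum_nonneg fun j _ => abs_nonneg _)
    rw [Finset.sum_eq_zero_iff_of_nonneg fun i _ => Finset.sum_nonneg fun j _ => abs_nonneg _] at h0
    ext i j
    have h1 := h0 i (Finset.mem_univ i)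
    rw [Finset.sum_eq_zero_iff_of_nonneg fun j _ => abs_nonneg _] at h1
    exact sub_eq_zero.1 (abs_eq_zero.1 (h1 j (Finset.mem_univ j)))
  · intro h
    simp [h]

theorem exists_toMatrix_eq (n : ℕ) (Q : Matrix (Fin n) (Fin n) ℚ) :
    ∃ M : MatCode, toMatrix n M = Q := by
  refine ⟨tabulate n fun i j => if h : i < n ∧ j < n then
    ofRatCode (ratCode (Q ⟨i, h.1⟩ ⟨j, h.2⟩)) else FracCode.ofNat 0, ?_⟩
  ext i j
  rw [toMatrix_tabulate, dif_pos ⟨i.2, j.2⟩, val_ofRatCode]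

section Primrec

variable {α : Type*} [Primcodable α] {n k i j : α → ℕ} {M N : α → MatCode}

theorem primrec_entry (hM : Primrec M) (hi : Primrec i) (hj : Primrec j) :
    Primrec fun a => entry (M a) (i a) (j a) :=
  (Primrec.list_getD _).comp ((Primrec.list_getD _).comp hM hi) hj

theorem primrec_tabulate {f : α → ℕ → ℕ → FracCode} (hn : Primrec n)
    (hf : Primrec fun p : (α × ℕ) × ℕ => f p.1.1 p.1.2 p.2) :
    Primrec fun a => tabulate (n a) (f a) := by
  refine Primrec.list_map (Primrec.list_range.comp hn) (Primrec₂.mk ?_)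
  exact Primrec.list_map (Primrec.list_range.comp (hn.comp Primrec.fst)) (Primrec₂.mk hf)

theorem primrec_mul (hn : Primrec n) (hM : Primrec M) (hN : Primrec N) :
    Primrec fun a => mul (n a) (M a) (N a) := by
  have e : Primrec fun p : ((α × ℕ) × ℕ) × ℕ => p.1.1.1 :=
    Primrec.fst.comp (Primrec.fst.comp Primrec.fst)
  refine primrec_tabulate hn (primrec_sumTo (hn.comp (Primrec.fst.comp Primrec.fst))
    (FracCode.primrec_mul (primrec_entry (hM.comp e) ?_ Primrec.snd)
      (primrec_entry (hN.comp e) Primrec.snd ?_)))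
  · exact Primrec.snd.comp (Primrec.fst.comp Primrec.fst)
  · exact Primrec.snd.comp Primrec.fst

theorem primrec_one (hn : Primrec n) : Primrec fun a => one (n a) := by
  refine primrec_tabulate hn (primrec_ofNat (Primrec.ite (Primrec.eq.comp ?_ ?_)
    (Primrec.const 1) (Primrec.const 0)))
  · exact Primrec.snd.comp Primrec.fst
  · exact Primrec.snd

theorem primrec_pow (hn : Primrec n) (hM : Primrec M) (hk : Primrec k) :
    Primrec fun a => pow (n a) (M a) (k a) := by
  refine Primrec.nat_rec' hk (primrec_one hn) (h := fun a p => mul (n a) p.2 (M a))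
    (Primrec₂.mk ?_)
  exact primrec_mul (hn.comp Primrec.fst) (Primrec.snd.comp Primrec.snd) (hM.comp Primrec.fst)

theorem primrec_dist (hn : Primrec n) (hM : Primrec M) (hN : Primrec N) :
    Primrec fun a => dist (n a) (M a) (N a) := by
  have e : Primrec fun p : (α × ℕ) × ℕ => p.1.1 := Primrec.fst.comp Primrec.fst
  have e' : Primrec fun p : (α × ℕ) × ℕ => p.1.2 := Primrec.snd.comp Primrec.fst
  exact primrec_sumTo hn (primrec_sumTo (hn.comp Primrec.fst)
    (FracCode.primrec_dist (primrec_entry (hM.comp e) e' Primrec.snd)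
      (primrec_entry (hN.comp e) e' Primrec.snd)))

end Primrec

end MatCode

/-! ### Checking certificates by primitive recursion. -/

/-- Codes of the data in a `PowerProblem`. -/
abbrev ProblemCode :=
  List (List (List RatCode)) × List RatCode × List Bool × List (Option ℕ)

/-- Codes of the exponent, the limit matrices and the error bound in a certificate. -/
abbrev CertificateCode := ℕ × List MatCode × FracCode

namespace ProblemCode

open FracCode

/-- Read from `u`, because the list of matrices may be empty. -/
def dim (c : ProblemCode) : ℕ := c.2.1.length

def count (c : ProblemCode) : ℕ := c.1.length

def matrix (c : ProblemCode) (t : ℕ) : MatCode :=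
  MatCode.tabulate c.dim fun i j => ofRatCode (((c.1.getD t []).getD i []).getD j (0, 1))

def initial (c : ProblemCode) (i : ℕ) : FracCode := ofRatCode (c.2.1.getD i (0, 1))

def final (c : ProblemCode) (i : ℕ) : FracCode :=
  FracCode.ofNat (bif c.2.2.1.getD i false then 1 else 0)

def exponent (c : ProblemCode) (t : ℕ) : Option ℕ := c.2.2.2.getD t none

/-- The factor with index `t`; the residue class of its exponent is a digit of `r`. -/
def factor (c : ProblemCode) (s : CertificateCode) (r t : ℕ) : MatCode :=
  (c.exponent t).elim
    (MatCode.mul c.dim (MatCode.pow c.dim (c.matrix t) (r / s.1 ^ t % s.1)) (s.2.1.getD t []))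
    fun j => MatCode.pow c.dim (c.matrix t) j

def product (c : ProblemCode) (s : CertificateCode) (r m : ℕ) : MatCode :=
  m.rec (MatCode.one c.dim) fun t P => MatCode.mul c.dim P (c.factor s r t)

def value (c : ProblemCode) (s : CertificateCode) (r : ℕ) : FracCode :=
  sumTo c.dim fun i => FracCode.mul (c.initial i)
    (sumTo c.dim fun j =>
      FracCode.mul ((c.product s r c.count).entry i j) (c.final j))

/-- The equations and inequalities that make `s` a certificate. -/
def Valid (c : ProblemCode) (s : CertificateCode) : Prop :=
  -- Positivity of the error bound ensures that separation by more than `ℓ * δ` excludes equality.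
  0 < s.1 ∧ FracCode.Lt (FracCode.ofNat 0) s.2.2 ∧ FracCode.Lt s.2.2 (FracCode.ofNat 1) ∧
  ∀ t < c.count,
    FracCode.Le (MatCode.dist c.dim (MatCode.mul c.dim (MatCode.pow c.dim (c.matrix t) s.1)
      (s.2.1.getD t [])) (s.2.1.getD t [])) (FracCode.ofNat 0) ∧
    FracCode.Le (MatCode.dist c.dim (MatCode.mul c.dim (s.2.1.getD t [])
      (MatCode.pow c.dim (c.matrix t) s.1)) (s.2.1.getD t [])) (FracCode.ofNat 0) ∧
    FracCode.Le (MatCode.dist c.dim (MatCode.mul c.dim (s.2.1.getD t [])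
      (s.2.1.getD t [])) (s.2.1.getD t [])) (FracCode.ofNat 0) ∧
    FracCode.Le (MatCode.dist c.dim (MatCode.pow c.dim (c.matrix t) s.1)
      (s.2.1.getD t [])) s.2.2

section Primrec

theorem primrec_dim : Primrec dim :=
  Primrec.list_length.comp (Primrec.fst.comp Primrec.snd)

theorem primrec_count : Primrec count := Primrec.list_length.comp Primrec.fst

variable {α : Type*} [Primcodable α] {c : α → ProblemCode} {s : α → CertificateCode}
  {r t i m : α → ℕ}

theorem primrec_matrix (hc : Primrec c) (ht : Primrec t) :
    Primrec fun a => (c a).matrix (t a) := by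
  have e : Primrec fun p : (α × ℕ) × ℕ => p.1.1 := Primrec.fst.comp Primrec.fst
  refine MatCode.primrec_tabulate (primrec_dim.comp hc) (primrec_ofRatCode.comp
    ((Primrec.list_getD _).comp ((Primrec.list_getD _).comp ((Primrec.list_getD _).comp
      (Primrec.fst.comp (hc.comp e)) (ht.comp e)) ?_) Primrec.snd))
  exact Primrec.snd.comp Primrec.fst

theorem primrec_initial (hc : Primrec c) (hi : Primrec i) :
    Primrec fun a => (c a).initial (i a) :=
  primrec_ofRatCode.comp ((Primrec.list_getD _).comp
    (Primrec.fst.comp (Primrec.snd.comp hc)) hi)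

theorem primrec_final (hc : Primrec c) (hi : Primrec i) :
    Primrec fun a => (c a).final (i a) :=
  primrec_ofNat (Primrec.cond ((Primrec.list_getD _).comp
    (Primrec.fst.comp (Primrec.snd.comp (Primrec.snd.comp hc))) hi)
    (Primrec.const 1) (Primrec.const 0))

theorem primrec_exponent (hc : Primrec c) (ht : Primrec t) :
    Primrec fun a => (c a).exponent (t a) :=
  (Primrec.list_getD _).comp (Primrec.snd.comp (Primrec.snd.comp (Primrec.snd.comp hc))) ht

theorem primrec_limit (hs : Primrec s) (ht : Primrec t) :
    Primrec fun a => (s a).2.1.getD (t a) [] :=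
  (Primrec.list_getD _).comp (Primrec.fst.comp (Primrec.snd.comp hs)) ht

theorem primrec₂_nat_pow : Primrec₂ ((· ^ ·) : ℕ → ℕ → ℕ) :=
  Primrec₂.unpaired'.1 Nat.Primrec.pow

theorem primrec_factor (hc : Primrec c) (hs : Primrec s) (hr : Primrec r) (ht : Primrec t) :
    Primrec fun a => (c a).factor (s a) (r a) (t a) := by
  have hd : Primrec fun a => (c a).dim := primrec_dim.comp hc
  have hA := primrec_matrix hc ht
  have he : Primrec fun a => (s a).1 := Primrec.fst.comp hs
  have hnone : Primrec fun a => MatCode.mul (c a).dim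
      (MatCode.pow (c a).dim ((c a).matrix (t a)) (r a / (s a).1 ^ t a % (s a).1))
      ((s a).2.1.getD (t a) []) :=
    MatCode.primrec_mul hd (MatCode.primrec_pow hd hA (Primrec.nat_mod.comp
      (Primrec.nat_div.comp hr (primrec₂_nat_pow.comp he ht)) he)) (primrec_limit hs ht)
  have hsome : Primrec₂ fun a j => MatCode.pow (c a).dim ((c a).matrix (t a)) j :=
    Primrec₂.mk (MatCode.primrec_pow (hd.comp Primrec.fst) (hA.comp Primrec.fst) Primrec.snd)
  refine (Primrec.option_casesOn (primrec_exponent hc ht) hnone hsome).of_eq fun a => ?_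
  unfold factor
  cases (c a).exponent (t a) <;> rfl

theorem primrec_product (hc : Primrec c) (hs : Primrec s) (hr : Primrec r) (hm : Primrec m) :
    Primrec fun a => (c a).product (s a) (r a) (m a) := by
  refine Primrec.nat_rec' hm (MatCode.primrec_one (primrec_dim.comp hc))
    (h := fun a p => MatCode.mul (c a).dim p.2 ((c a).factor (s a) (r a) p.1)) (Primrec₂.mk ?_)
  have e : Primrec fun p : α × ℕ × MatCode => p.1 := Primrec.fst
  exact MatCode.primrec_mul (primrec_dim.comp (hc.comp e)) (Primrec.snd.comp Primrec.snd)
    (primrec_factor (hc.comp e) (hs.comp e) (hr.comp e) (Primrec.fst.comp Primrec.snd))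

theorem primrec_value (hc : Primrec c) (hs : Primrec s) (hr : Primrec r) :
    Primrec fun a => (c a).value (s a) (r a) := by
  have hd : Primrec fun a => (c a).dim := primrec_dim.comp hc
  have e : Primrec fun p : (α × ℕ) × ℕ => p.1.1 := Primrec.fst.comp Primrec.fst
  have e' : Primrec fun p : (α × ℕ) × ℕ => p.1.2 := Primrec.snd.comp Primrec.fst
  exact primrec_sumTo hd (FracCode.primrec_mul
    (primrec_initial (hc.comp Primrec.fst) Primrec.snd)
    (primrec_sumTo (hd.comp Primrec.fst) (FracCode.primrec_mul
      (MatCode.primrec_entry ((primrec_product hc hs hr (primrec_count.comp hc)).comp e)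
        e' Primrec.snd)
      (primrec_final (hc.comp e) Primrec.snd))))

/-- Bounded quantification, with the bound and the predicate depending on a parameter. -/
theorem primrecPred_forall_lt {p : α → ℕ → Prop} (hm : Primrec m)
    (hp : PrimrecPred fun q : α × ℕ => p q.1 q.2) : PrimrecPred fun a => ∀ x < m a, p a x := by
  have h : PrimrecRel fun (x : ℕ) (a : α) => p a x :=
    (hp.comp (Primrec.snd.pair Primrec.fst) : PrimrecPred fun q : ℕ × α => p q.2 q.1)
  exact (h.forall_mem_list.comp (Primrec.list_range.comp hm) Primrec.id).of_eq (by simp)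

theorem primrecPred_valid (hc : Primrec c) (hs : Primrec s) :
    PrimrecPred fun a => (c a).Valid (s a) := by
  have hd : Primrec fun a => (c a).dim := primrec_dim.comp hc
  have he : Primrec fun a => (s a).1 := Primrec.fst.comp hs
  have hδ : Primrec fun a => (s a).2.2 := Primrec.snd.comp (Primrec.snd.comp hs)
  have c0 : Primrec fun _ : α => FracCode.ofNat 0 := Primrec.const _
  have c1 : Primrec fun _ : α => FracCode.ofNat 1 := Primrec.const _
  have e : Primrec fun p : α × ℕ => p.1 := Primrec.fst
  have hL : Primrec fun p : α × ℕ => (s p.1).2.1.getD p.2 [] :=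
    primrec_limit (hs.comp e) Primrec.snd
  have hX : Primrec fun p : α × ℕ => MatCode.pow (c p.1).dim ((c p.1).matrix p.2) (s p.1).1 :=
    MatCode.primrec_pow (hd.comp e) (primrec_matrix (hc.comp e) Primrec.snd) (he.comp e)
  have hd' := hd.comp e
  refine (Primrec.nat_lt.comp (Primrec.const 0) he).and
    ((primrecPred_lt c0 hδ).and ((primrecPred_lt hδ c1).and
      (primrecPred_forall_lt (primrec_count.comp hc) ?_)))
  exact (primrecPred_le (MatCode.primrec_dist hd' (MatCode.primrec_mul hd' hX hL) hL)
      (c0.comp e)).and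
    ((primrecPred_le (MatCode.primrec_dist hd' (MatCode.primrec_mul hd' hL hX) hL)
      (c0.comp e)).and
    ((primrecPred_le (MatCode.primrec_dist hd' (MatCode.primrec_mul hd' hL hL) hL)
      (c0.comp e)).and
    (primrecPred_le (MatCode.primrec_dist hd' hX hL) (hδ.comp e))))

end Primrec

end ProblemCode

/-! ### Agreement of the coded computations with the problem. -/

/-- The code of a problem as it occurs in `inputCode`. -/
def PowerProblem.code (I : PowerProblem) : ProblemCode :=
  (List.ofFn fun t => List.ofFn fun i => List.ofFn fun j => ratCode (I.A t i j),
    List.ofFn fun i => ratCode (I.u i), List.ofFn I.v, List.ofFn I.fixed)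

namespace ProblemCode

open FracCode PowerProblem

variable (I : PowerProblem)

@[simp] theorem dim_code : I.code.dim = I.n := by simp [dim, code]

@[simp] theorem count_code : I.code.count = I.ℓ := by simp [count, code]

theorem toMatrix_matrix (t : Fin I.ℓ) : (I.code.matrix t).toMatrix I.n = I.A t := by
  ext i j
  rw [matrix, dim_code, MatCode.toMatrix_tabulate, ← val_ofRatCode (I.A t i j)]
  simp [code]

theorem val_initial (i : Fin I.n) : val (I.code.initial i) = I.u i := by
  rw [← val_ofRatCode (I.u i)]
  simp [initial, code]

theorem val_final (i : Fin I.n) : val (I.code.final i) = I.ratV i := by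
  cases h : I.v i <;> simp [final, code, ratV, h]

theorem exponent_code (t : Fin I.ℓ) : I.code.exponent t = I.fixed t := by
  simp [exponent, code]

/-- The limit matrices in the code of a certificate. -/
def limits (s : CertificateCode) (t : Fin I.ℓ) : Matrix (Fin I.n) (Fin I.n) ℚ :=
  MatCode.toMatrix I.n (s.2.1.getD t [])

/-- The digits of `r` in base `e`. -/
def digit (e r t : ℕ) : ℕ := r / e ^ t % e

theorem toMatrix_factor (s : CertificateCode) (r : ℕ) (t : Fin I.ℓ) :
    (I.code.factor s r t).toMatrix I.n =
      I.residueFactor (limits I s) (fun t => digit s.1 r t) t := by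
  rw [factor, exponent_code, residueFactor]
  cases I.fixed t with
  | none =>
    simp only [Option.elim_none, dim_code, MatCode.toMatrix_mul, MatCode.toMatrix_pow,
      toMatrix_matrix, limits, digit]
  | some j =>
    simp only [Option.elim_some, dim_code, MatCode.toMatrix_pow, toMatrix_matrix]

theorem toMatrix_product (s : CertificateCode) (r : ℕ) {m : ℕ} (hm : m ≤ I.ℓ) :
    (I.code.product s r m).toMatrix I.n =
      ((List.ofFn (I.residueFactor (limits I s) fun t => digit s.1 r t)).take m).prod := by
  induction m with
  | zero =>
    rw [List.take_zero, List.prod_nil, ← MatCode.toMatrix_one, ← dim_code]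
    rfl
  | succ m ih =>
    have hlt : m < I.ℓ := hm
    have h : I.code.product s r (m + 1) =
        MatCode.mul I.code.dim (I.code.product s r m) (I.code.factor s r m) := rfl
    rw [h, dim_code, MatCode.toMatrix_mul, ih hlt.le, toMatrix_factor I s r ⟨m, hlt⟩,
      List.prod_take_succ _ _ (by simpa using hlt), List.getElem_ofFn]

theorem val_value (s : CertificateCode) (r : ℕ) :
    val (I.code.value s r) = I.residueValue (limits I s) fun t => digit s.1 r t := by
  have h : (I.code.product s r I.ℓ).toMatrix I.n =
      (List.ofFn (I.residueFactor (limits I s) fun t => digit s.1 r t)).prod := by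
    rw [toMatrix_product I s r le_rfl, List.take_of_length_le (by simp)]
  simp only [value, val_sumTo, val_mul, dim_code, count_code, val_initial, val_final,
    residueValue, ← h]
  rfl

/-- Every family of residues is given by the digits of a number. -/
theorem exists_digit_eq {e ℓ : ℕ} (r : Fin ℓ → Fin e) :
    ∃ R < e ^ ℓ, ∀ t : Fin ℓ, digit e R t = r t := by
  refine ⟨finFunctionFinEquiv r, (finFunctionFinEquiv r).2, fun t => ?_⟩
  have h := congrFun (finFunctionFinEquiv.symm_apply_apply r) t
  exact congrArg Fin.val h

theorem Valid.isCertificate {I : PowerProblem} {s : CertificateCode} (h : I.code.Valid s) :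
    I.IsCertificate s.1 (limits I s) (val s.2.2 : ℚ) := by
  obtain ⟨h0, -, h1, h2⟩ := h
  refine ⟨h0, ?_, fun t => ?_⟩
  · rw [lt_iff, val_ofNat] at h1
    exact_mod_cast h1
  · obtain ⟨ha, hb, hc, hd⟩ := h2 t (by simp)
    simp only [dim_code, le_iff, val_ofNat, Nat.cast_zero, MatCode.val_dist_nonpos_iff,
      MatCode.toMatrix_mul, MatCode.toMatrix_pow, toMatrix_matrix] at ha hb hc hd
    rw [realA_eq]
    refine ⟨?_, ?_, ?_, fun i => ?_⟩
    · rw [← map_pow, ← map_mul]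
      exact congrArg castMatrix ha
    · rw [← map_pow, ← map_mul]
      exact congrArg castMatrix hb
    · rw [← map_mul]
      exact congrArg castMatrix hc
    -- The checked distance sums over all rows, so it dominates the sum over any single row.
    · rw [MatCode.val_dist, MatCode.toMatrix_pow, toMatrix_matrix] at hd
      have h3 : ∑ j, |(I.A t ^ s.1) i j - limits I s t i j| ≤ val s.2.2 :=
        (Finset.single_le_sum (f := fun i => ∑ j, |(I.A t ^ s.1) i j - limits I s t i j|)
          (fun _ _ => Finset.sum_nonneg fun _ _ => abs_nonneg _) (Finset.mem_univ i)).trans hd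
      rw [← map_pow]
      simp only [castMatrix, RingHom.mapMatrix_apply, Matrix.map_apply, Rat.coe_castHom]
      exact_mod_cast h3

/-- Certificates with an arbitrarily small error bound exist. -/
theorem exists_valid {η : ℝ} (hη : 0 < η) :
    ∃ s : CertificateCode, I.code.Valid s ∧ ((val s.2.2 : ℚ) : ℝ) < η := by
  obtain ⟨δ, hδ0, hδ⟩ : ∃ δ : ℚ, (0 : ℝ) < δ ∧ (δ : ℝ) < min η 1 :=
    exists_rat_btwn (by positivity)
  have hn : (0 : ℝ) < (I.n : ℝ) + 1 := by positivity
  have hδ1 : (δ : ℝ) < 1 := hδ.trans_le (min_le_right _ _)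
  -- Row errors of `δ / (n + 1)` keep the sum over all `n` rows below `δ`.
  obtain ⟨e, L, h⟩ := I.exists_isCertificate (δ := δ / (I.n + 1)) (by positivity)
    ((div_le_self hδ0.le (by linarith [Nat.cast_nonneg (α := ℝ) I.n])).trans_lt hδ1)
  choose M hM using fun t => MatCode.exists_toMatrix_eq I.n (L t)
  have hlim : limits I (e, List.ofFn M, ofRatCode (ratCode δ)) = L := by
    funext t
    simp [limits, hM]
  refine ⟨(e, List.ofFn M, ofRatCode (ratCode δ)), ⟨h.pos, ?_, ?_, fun t ht => ?_⟩, ?_⟩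
  · rw [lt_iff, val_ofRatCode, val_ofNat]
    exact_mod_cast hδ0
  · rw [lt_iff, val_ofRatCode, val_ofNat]
    exact_mod_cast hδ1
  · rw [count_code] at ht
    have hinj : Function.Injective (castMatrix (n := I.n)) :=
      Matrix.map_injective (Rat.cast_injective (α := ℝ))
    have hcert := h.cert ⟨t, ht⟩
    have hA := toMatrix_matrix I ⟨t, ht⟩
    have hMt : MatCode.toMatrix I.n ((List.ofFn M).getD t []) = L ⟨t, ht⟩ :=
      congrFun hlim ⟨t, ht⟩
    simp only at hA
    simp only [dim_code, le_iff, val_ofNat, Nat.cast_zero, MatCode.val_dist_nonpos_iff,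
      MatCode.toMatrix_mul, MatCode.toMatrix_pow, hA, hMt, val_ofRatCode]
    rw [realA_eq] at hcert
    refine ⟨hinj ?_, hinj ?_, hinj ?_, ?_⟩
    · rw [map_mul, map_pow, hcert.left]
    · rw [map_mul, map_pow, hcert.right]
    · rw [map_mul, hcert.idem]
    · rw [MatCode.val_dist, MatCode.toMatrix_pow, hA, hMt]
      have h1 : ∀ i, ∑ j, |(((I.A ⟨t, ht⟩ ^ e) i j : ℚ) : ℝ) - (L ⟨t, ht⟩ i j : ℚ)| ≤
          δ / (I.n + 1) := by
        intro i
        have := hcert.close i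
        rw [← map_pow] at this
        exact this
      have h2 : ∑ i, ∑ j, |(((I.A ⟨t, ht⟩ ^ e) i j : ℚ) : ℝ) - (L ⟨t, ht⟩ i j : ℚ)| ≤ δ := by
        refine (Finset.sum_le_sum fun i _ => h1 i).trans ?_
        rw [Finset.sum_const, Finset.card_univ, Fintype.card_fin, nsmul_eq_mul, mul_div_assoc',
          div_le_iff₀ hn]
        nlinarith
      exact_mod_cast h2
  · rw [val_ofRatCode]
    exact hδ.trans_le (min_le_left _ _)

end ProblemCode

/-! ### Polynomial evaluation on codes. -/

namespace FracCode

/-- The value of the polynomial with coefficients `cs`, by Horner's scheme. -/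
def poly (cs : List ℤ) (q : FracCode) : FracCode :=
  cs.foldr (fun z y => add (ofRatCode (z, 1)) (mul q y)) (ofNat 0)

/-- A code of `hornerBound cs`. -/
def polyBound (cs : List ℤ) : FracCode :=
  cs.foldr (fun z y => add (dist (ofRatCode (z, 1)) (ofNat 0)) (mul (ofNat 2) y)) (ofNat 0)

theorem val_poly (cs : List ℤ) (q : FracCode) : val (poly cs q) = horner cs (val q) := by
  induction cs with
  | nil => simp [poly, horner]
  | cons z cs ih =>
    change val (add (ofRatCode (z, 1)) (mul q (poly cs q))) = z + val q * horner cs (val q)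
    rw [val_add, val_mul, ih, val_ofRatCode_int]

theorem val_polyBound (cs : List ℤ) : val (polyBound cs) = hornerBound cs := by
  induction cs with
  | nil => simp [polyBound, hornerBound]
  | cons z cs ih =>
    change val (add (dist (ofRatCode (z, 1)) (ofNat 0)) (mul (ofNat 2) (polyBound cs))) =
      |(z : ℚ)| + 2 * hornerBound cs
    rw [val_add, val_mul, ih, val_dist, val_ofRatCode_int]
    simp

theorem primrec_ofInt {α : Type*} [Primcodable α] {z : α → ℤ} (hz : Primrec z) :
    Primrec fun a => ofRatCode (z a, 1) :=
  primrec_ofRatCode.comp (hz.pair (Primrec.const 1))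

theorem primrec_poly {α : Type*} [Primcodable α] {cs : α → List ℤ} {q : α → FracCode}
    (hcs : Primrec cs) (hq : Primrec q) : Primrec fun a => poly (cs a) (q a) := by
  refine Primrec.list_foldr hcs (Primrec.const (ofNat 0))
    (h := fun a p => add (ofRatCode (p.1, 1)) (mul (q a) p.2)) (Primrec₂.mk ?_)
  exact primrec_add (primrec_ofInt (Primrec.fst.comp Primrec.snd))
    (primrec_mul (hq.comp Primrec.fst) (Primrec.snd.comp Primrec.snd))

theorem primrec_polyBound {α : Type*} [Primcodable α] {cs : α → List ℤ} (hcs : Primrec cs) :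
    Primrec fun a => polyBound (cs a) := by
  refine Primrec.list_foldr hcs (Primrec.const (ofNat 0)) (h := fun _ p =>
    add (dist (ofRatCode (p.1, 1)) (ofNat 0)) (mul (ofNat 2) p.2)) (Primrec₂.mk ?_)
  exact primrec_add (primrec_dist (primrec_ofInt (Primrec.fst.comp Primrec.snd))
    (Primrec.const _)) (primrec_mul (Primrec.const _) (Primrec.snd.comp Primrec.snd))

end FracCode

/-! ### Witnesses and the unbounded search for them. -/

/-- A certificate together with the claim that the number is attained at `ω` (and the digits
of the residues for which it is), or that it is not. -/
abbrev WitnessCode := CertificateCode × Bool × ℕ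

namespace WitnessCode

open FracCode

/-- The witness `w` settles the question for the input `a`. -/
def Accepts (a : InputCode) (w : WitnessCode) : Prop :=
  ProblemCode.Valid a.1 w.1 ∧
  -- A positive claim is checked by `|p(w)| ≤ 0` at one value; a negative one by `B * ℓ * δ <
  -- |p(w)|` at all `e ^ ℓ` families of residues, where `B` is `hornerBound`.
  ((w.2.1 = true ∧ FracCode.Le (FracCode.dist (poly a.2.1 (ProblemCode.value a.1 w.1 w.2.2))
      (FracCode.ofNat 0)) (FracCode.ofNat 0)) ∨
    (w.2.1 = false ∧ ∀ r < w.1.1 ^ ProblemCode.count a.1,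
      FracCode.Lt (FracCode.mul (FracCode.mul (polyBound a.2.1)
          (FracCode.ofNat (ProblemCode.count a.1))) w.1.2.2)
        (FracCode.dist (poly a.2.1 (ProblemCode.value a.1 w.1 r)) (FracCode.ofNat 0))))

theorem primrecPred_accepts : PrimrecPred fun p : InputCode × WitnessCode => Accepts p.1 p.2 := by
  have hc : Primrec fun p : InputCode × WitnessCode => p.1.1 := Primrec.fst.comp Primrec.fst
  have hcs : Primrec fun p : InputCode × WitnessCode => p.1.2.1 :=
    Primrec.fst.comp (Primrec.snd.comp Primrec.fst)
  have hs : Primrec fun p : InputCode × WitnessCode => p.2.1 := Primrec.fst.comp Primrec.snd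
  have hb : Primrec fun p : InputCode × WitnessCode => p.2.2.1 :=
    Primrec.fst.comp (Primrec.snd.comp Primrec.snd)
  have hr : Primrec fun p : InputCode × WitnessCode => p.2.2.2 :=
    Primrec.snd.comp (Primrec.snd.comp Primrec.snd)
  have hcount := ProblemCode.primrec_count.comp hc
  refine (ProblemCode.primrecPred_valid hc hs).and (((Primrec.eq.comp hb (Primrec.const true)).and
    (primrecPred_le (primrec_dist (primrec_poly hcs (ProblemCode.primrec_value hc hs hr))
      (Primrec.const _)) (Primrec.const _))).or ((Primrec.eq.comp hb (Primrec.const false)).and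
    (ProblemCode.primrecPred_forall_lt
      (ProblemCode.primrec₂_nat_pow.comp (Primrec.fst.comp hs) hcount) ?_)))
  have e : Primrec fun q : (InputCode × WitnessCode) × ℕ => q.1 := Primrec.fst
  exact primrecPred_lt
    (FracCode.primrec_mul (FracCode.primrec_mul (primrec_polyBound (hcs.comp e))
      (primrec_ofNat (hcount.comp e))) (Primrec.snd.comp (Primrec.snd.comp (hs.comp e))))
    (primrec_dist (primrec_poly (hcs.comp e)
      (ProblemCode.primrec_value (hc.comp e) (hs.comp e) Primrec.snd)) (Primrec.const _))

open Classical in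
/-- The `k`-th candidate for a witness, if it is accepted. -/
noncomputable def candidate (a : InputCode) (k : ℕ) : Option WitnessCode :=
  (Encodable.decode (α := WitnessCode) k).bind fun w => if Accepts a w then some w else none

/-- The search for a witness. -/
noncomputable def search (a : InputCode) : Part WitnessCode := Nat.rfindOpt (candidate a)

theorem primrec₂_candidate : Primrec₂ candidate := by
  classical
  refine Primrec₂.mk (Primrec.option_bind (Primrec.decode.comp Primrec.snd) (Primrec₂.mk ?_))
  have h : Primrec fun q : (InputCode × ℕ) × WitnessCode => (q.1.1, q.2) :=
    (Primrec.fst.comp Primrec.fst).pair Primrec.snd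
  exact Primrec.ite (primrecPred_accepts.comp h) (Primrec.option_some.comp Primrec.snd)
    (Primrec.const none)

theorem partrec_search : Partrec search := Partrec.rfindOpt primrec₂_candidate.to_comp

/-- The search may stop at a witness other than the given one, but whatever it returns has been
checked. -/
theorem exists_mem_search {a : InputCode} (h : ∃ w, Accepts a w) :
    ∃ w ∈ search a, Accepts a w := by
  obtain ⟨w, hw⟩ := h
  have hdom : (search a).Dom :=
    Nat.rfindOpt_dom.2 ⟨Encodable.encode w, w, by simp [candidate, hw]⟩
  refine ⟨(search a).get hdom, Part.get_mem hdom, ?_⟩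
  obtain ⟨k, hk⟩ := Nat.rfindOpt_spec (Part.get_mem hdom)
  simp only [candidate, Option.mem_def, Option.bind_eq_some_iff, Option.ite_none_right_eq_some,
    Option.some.injEq] at hk
  obtain ⟨w', -, hacc, hw'⟩ := hk
  exact hw' ▸ hacc

section Correctness

variable {I : PowerProblem} {x : ℝ}

theorem inputCode_fst (ρ : StandardRep (x : ℂ)) : (inputCode I ρ).1 = I.code := rfl

theorem abs_poly_eq (ρ : StandardRep (x : ℂ)) (q : FracCode) :
    val (FracCode.dist (poly (inputCode I ρ).2.1 q) (FracCode.ofNat 0)) =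
      |horner (inputCode I ρ).2.1 (val q)| := by
  rw [FracCode.val_dist, val_poly, val_ofNat, Nat.cast_zero, sub_zero]

theorem horner_inputCode_eq_zero_iff (ρ : StandardRep (x : ℂ)) (s : ℚ) :
    horner (inputCode I ρ).2.1 s = 0 ↔ x = s := ρ.horner_eq_zero_iff s

theorem value_mem (s : CertificateCode) (hs : I.code.Valid s) (r : ℕ) :
    ((val (I.code.value s r) : ℚ) : ℝ) ∈ I.values I.omegaExponents := by
  rw [ProblemCode.val_value]
  exact (hs.isCertificate.mem_values_omega_iff _).2
    ⟨fun t => ⟨ProblemCode.digit s.1 r t, Nat.mod_lt _ hs.isCertificate.pos⟩, rfl⟩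

theorem exists_value_eq (s : CertificateCode) (hs : I.code.Valid s) {w : ℝ}
    (hw : w ∈ I.values I.omegaExponents) :
    ∃ r < s.1 ^ I.ℓ, ((val (I.code.value s r) : ℚ) : ℝ) = w := by
  obtain ⟨r, rfl⟩ := (hs.isCertificate.mem_values_omega_iff _).1 hw
  obtain ⟨R, hR, hdig⟩ := ProblemCode.exists_digit_eq r
  refine ⟨R, hR, ?_⟩
  rw [ProblemCode.val_value]
  simp only [hdig]

/-- In the negative case `p(x) = 0` gives `B * ℓ * δ < |p(y)| ≤ B * |x - y|` for every value `y` at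
`ω`; cancelling `B` yields the separation that `isBound` requires. -/
theorem Accepts.sound (hx : x ∈ Set.Icc (0 : ℝ) 1) {ρ : StandardRep (x : ℂ)} {w : WitnessCode}
    (h : Accepts (inputCode I ρ) w) :
    (w.2.1 = true ∧ I.AttainedAtOmega x) ∨
      (w.2.1 = false ∧ ¬ I.AttainedAtOmega x ∧ I.IsBound x w.1.1) := by
  obtain ⟨hv, h⟩ := h
  rw [inputCode_fst] at hv
  refine h.imp (fun h => ⟨h.1, ?_⟩) fun h => ⟨h.1, ?_⟩
  · have h1 := h.2
    rw [le_iff, abs_poly_eq, val_ofNat, Nat.cast_zero, abs_nonpos_iff,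
      horner_inputCode_eq_zero_iff] at h1
    rw [h1]
    exact value_mem w.1 hv w.2.2
  · have hsep : ∀ y ∈ I.values I.omegaExponents, I.ℓ * ((val w.1.2.2 : ℚ) : ℝ) < |x - y| := by
      intro y hy
      obtain ⟨r, hr, rfl⟩ := exists_value_eq w.1 hv hy
      have h1 := h.2 r (by rwa [inputCode_fst, ProblemCode.count_code])
      rw [lt_iff, abs_poly_eq, val_mul, val_mul, val_polyBound, val_ofNat, inputCode_fst,
        ProblemCode.count_code] at h1
      have h2 : (hornerBound (inputCode I ρ).2.1 : ℝ) * I.ℓ * ((val w.1.2.2 : ℚ) : ℝ) <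
          |horner (inputCode I ρ).2.1 ((val (I.code.value w.1 r) : ℚ) : ℝ)| := by
        rw [← cast_horner]
        exact_mod_cast h1
      have h3 := abs_horner_sub_le (inputCode I ρ).2.1 hx (I.mem_Icc_of_mem_values hy)
      have h4 : horner (inputCode I ρ).2.1 x = 0 := ρ.horner_self
      rw [h4, zero_sub, abs_neg] at h3
      have h5 : (0 : ℝ) ≤ hornerBound (inputCode I ρ).2.1 := by
        exact_mod_cast hornerBound_nonneg _
      refine lt_of_mul_lt_mul_left ?_ h5
      rw [← mul_assoc]
      exact h2.trans_le h3
    refine ⟨fun hatt => ?_, hv.isCertificate.isBound hsep⟩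
    have h1 := hsep x hatt
    rw [sub_self, abs_zero] at h1
    have h2 : 0 < val w.1.2.2 := by
      have := hv.2.1
      rwa [lt_iff, val_ofNat, Nat.cast_zero] at this
    have h3 : (0 : ℝ) < ((val w.1.2.2 : ℚ) : ℝ) := by exact_mod_cast h2
    exact absurd h1 (not_lt.2 (by positivity))

/-- If `x` is not attained, `p` vanishes at none of the finitely many rational values at `ω`, so
`|p|` exceeds some `η > 0` there. Any certificate with `δ < η / (B * ℓ + 1)` then passes. -/
theorem exists_accepts (ρ : StandardRep (x : ℂ)) : ∃ w, Accepts (inputCode I ρ) w := by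
  by_cases hatt : I.AttainedAtOmega x
  · obtain ⟨s, hs, -⟩ := ProblemCode.exists_valid I one_pos
    obtain ⟨r, -, hr⟩ := exists_value_eq s hs hatt
    refine ⟨(s, true, r), hs, Or.inl ⟨rfl, ?_⟩⟩
    rw [le_iff, abs_poly_eq, val_ofNat, Nat.cast_zero, abs_nonpos_iff,
      horner_inputCode_eq_zero_iff]
    exact hr.symm
  · set cs := (inputCode I ρ).2.1 with hcs
    obtain ⟨η, hη, hgap⟩ := I.exists_gap (fun y => |horner cs y|) fun y hy => by
      -- This certificate serves only to show that `y` is rational; its error bound plays no role.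
      obtain ⟨s, hs, -⟩ := ProblemCode.exists_valid I one_pos
      obtain ⟨r, -, rfl⟩ := exists_value_eq s hs hy
      rw [← cast_horner, abs_pos, Rat.cast_ne_zero, Ne, hcs, horner_inputCode_eq_zero_iff]
      rintro rfl
      exact hatt hy
    have hB : (0 : ℝ) ≤ hornerBound cs := by exact_mod_cast hornerBound_nonneg cs
    have hK : (0 : ℝ) < hornerBound cs * I.ℓ + 1 := by positivity
    obtain ⟨s, hs, hδ⟩ := ProblemCode.exists_valid I (div_pos hη hK)
    refine ⟨(s, false, 0), hs, Or.inr ⟨rfl, fun r _ => ?_⟩⟩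
    have h1 := hgap _ (value_mem s hs r)
    rw [← cast_horner] at h1
    have h2 : (hornerBound cs : ℝ) * I.ℓ * ((val s.2.2 : ℚ) : ℝ) ≤ η := by
      rw [lt_div_iff₀ hK] at hδ
      have h3 : 0 < val s.2.2 := by
        have := hs.2.1
        rwa [lt_iff, val_ofNat, Nat.cast_zero] at this
      have h4 : (0 : ℝ) < ((val s.2.2 : ℚ) : ℝ) := by exact_mod_cast h3
      linarith
    rw [lt_iff, abs_poly_eq, val_mul, val_mul, val_polyBound, val_ofNat, inputCode_fst,
      ProblemCode.count_code]
    exact_mod_cast h2.trans_lt h1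

end Correctness

end WitnessCode

/-! ### The dichotomy and the two algorithms. -/

theorem mainTheorem2 :
    -- the dichotomy
    (∀ (I : PowerProblem) (x : ℝ), x ∈ Set.Icc (0 : ℝ) 1 →
      I.AttainedAtOmega x ∨ ∃ C : ℕ, I.IsBound x C) ∧
    -- an algorithm that halts on every valid input and decides whether the first case holds
    (∃ decider : InputCode →. Bool, Partrec decider ∧
      ∀ (I : PowerProblem) (x : ℝ), x ∈ Set.Icc (0 : ℝ) 1 → ∀ ρ : StandardRep (x : ℂ),
        ∃ b ∈ decider (inputCode I ρ), (b = true ↔ I.AttainedAtOmega x)) ∧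
    -- an algorithm that, in the second case, halts and outputs a constant
    (∃ bound : InputCode →. ℕ, Partrec bound ∧
      ∀ (I : PowerProblem) (x : ℝ), x ∈ Set.Icc (0 : ℝ) 1 → ∀ ρ : StandardRep (x : ℂ),
        ¬ I.AttainedAtOmega x → ∃ C ∈ bound (inputCode I ρ), I.IsBound x C) := by
  -- Both algorithms run the same search: one returns the claim made by the witness, the other the
  -- exponent of its certificate.
  refine ⟨fun I x _ => I.attainedAtOmega_or_isBound x,
    ⟨fun a => (WitnessCode.search a).map fun w => w.2.1, ?_, fun I x hx ρ => ?_⟩,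
    ⟨fun a => (WitnessCode.search a).map fun w => w.1.1, ?_, fun I x hx ρ hatt => ?_⟩⟩
  · exact WitnessCode.partrec_search.map
      (Primrec.fst.comp (Primrec.snd.comp Primrec.snd)).to_comp.to₂
  · obtain ⟨w, hw, hacc⟩ := WitnessCode.exists_mem_search (WitnessCode.exists_accepts (I := I) ρ)
    refine ⟨w.2.1, Part.mem_map _ hw, ?_⟩
    rcases hacc.sound hx with ⟨h, h'⟩ | ⟨h, h', -⟩
    · simp [h, h']
    · simp [h, h']
  · exact WitnessCode.partrec_search.map
      (Primrec.fst.comp (Primrec.fst.comp Primrec.snd)).to_comp.to₂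
  · obtain ⟨w, hw, hacc⟩ := WitnessCode.exists_mem_search (WitnessCode.exists_accepts (I := I) ρ)
    refine ⟨w.1.1, Part.mem_map _ hw, ?_⟩
    rcases hacc.sound hx with ⟨-, h'⟩ | ⟨-, -, h'⟩
    · exact absurd h' hatt
    · exact h'
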